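/- Let $\mathbb H$ be the upper half-plane with its hyperbolic metric $d$, and let $G$ be a Fuchsian group, i.e. a discrete group of orientation-preserving isometries of $\mathbb H$ acting by Möbius transformations (regarded as a discrete subgroup of $\mathrm{SL}_2(\mathbb R)$, to which every free Fuchsian group lifts isomorphically). Suppose that $G$ is free on hyperbolic elements $h_1,\dots,h_u$ and parabolic elements $\gamma_1,\dots,\gamma_v$, where $v\ge 1$ and $u+v>1$, and that the symmetric set $G_0=\{h_i^{\pm1},\gamma_j^{\pm1}\}$ is exactly the set of side-pairing elements of the Dirichlet domain $F=\{z\in\mathbb H: d(z,i)\le d(z,g(i))\ \text{for all } g\in G\}$, i.e. the set of $g\in G\setminus\{1\}$ for which $F\cap gF$ is a side of $F$ (contains more than one point). The side between the tiles $kF$ and $kgF$ ($k\in G$, $g\in G_0$), seen from $kF$, is labelled by $g$. Let $L_r(G)\subset\mathbb R\cup\{\infty\}$ be the radial limit set of $G$: the set of boundary points $x$ such that, for some $R>0$, the hyperbolic ray $s_x$ from $i$ towards $x$ contains points arbitrarily far from $i$ that are within distance $R$ of the orbit $G(i)$. For $x\in L_r(G)$ let $\omega_1\omega_2\cdots\in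 G_0^{\mathbb N}$ be the infinite word obtained by recording, starting at $i$, the labels of the sides through which $s_x$ successively exits the tiles $gF$, $g\in G$; thus $s_x$ passes from $\omega_1\cdots\omega_{n-1}F$ into $\omega_1\cdots\omega_nF$. Split this word into consecutive blocks $B_1(x),B_2(x),\dots$, where a block is either a single hyperbolic letter, or a maximal run of consecutive occurrences of the same parabolic letter. Let $|B_k(x)|$ be the number of letters of $B_k(x)$, put $a_k(x)=|B_k(x)|-1$, and put $\log^+(a)=\log a$ for $a>0$ and $\log^+(0)=0$. For $\alpha\in\mathbb R$ let $$\mathcal F_\alpha=\Big\{x\in L_r(G)\ :\ \lim_{n\to\infty}\frac{2\sum_{k=1}^n\log^+(a_k(x))}{d\big(B_1(x)\cdots B_n(x)(i),\,i\big)}=\alpha\Big\}$$ be the level set of the mean cusp-winding number. Then, for every $\alpha\in\mathbb R$, $\mathcal F_\alpha\ne\emptyset$ if and only if $\alpha\in[0,1]$. -/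

import Mathlib

open UpperHalfPlane Filter Topology
open scoped MatrixGroups Pointwise NNReal OnePoint

namespace CuspWinding

/-- The closed Dirichlet fundamental domain of `G` centred at `i`. -/
def dirichlet (G : Subgroup SL(2, ℝ)) : Set ℍ :=
  {z | ∀ g ∈ G, dist z I ≤ dist z (g • I)}

/-- The side-pairing elements of the Dirichlet domain `F`: those `g ≠ 1` in `G` for which the tile
`g F` is adjacent to `F` along a side, i.e. for which `F ∩ g F` (a convex subset of a geodesic) is
a geodesic segment of positive length. The side between the tiles `k F` and `k g F`, seen from
`k F`, carries the label `g`. -/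
def sidePairings (G : Subgroup SL(2, ℝ)) : Set SL(2, ℝ) :=
  {g | g ∈ G ∧ g ≠ 1 ∧ (dirichlet G ∩ g • dirichlet G).Nontrivial}

/-- `r` is the hyperbolic ray from `i` towards the boundary point `x ∈ ℝ ∪ {∞}`, parametrised by
arc length. Convergence to `x` takes place in the Riemann sphere `ℂ ∪ {∞}`. -/
def IsRayTo (r : ℝ≥0 → ℍ) (x : OnePoint ℝ) : Prop :=
  Isometry r ∧ r 0 = I ∧
    Tendsto (fun t => ((r t : ℂ) : OnePoint ℂ)) atTop (𝓝 (x.map (fun y : ℝ => (y : ℂ))))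

/-- The radial limit set: the boundary points `x` such that the ray from `i` towards `x` returns
infinitely often to some bounded neighbourhood of the orbit of `i`. -/
def radialLimitSet (G : Subgroup SL(2, ℝ)) : Set (OnePoint ℝ) :=
  {x | ∃ r, IsRayTo r x ∧ ∃ R : ℝ, ∀ T : ℝ≥0, ∃ t ≥ T, ∃ g ∈ G, dist (r t) (g • I) ≤ R}

/-- The product `ω₀ ω₁ ⋯ ωₙ₋₁` of the first `n` letters of the word `ω`. -/
def prefixProd (ω : ℕ → SL(2, ℝ)) (n : ℕ) : SL(2, ℝ) :=
  ((List.range n).map ω).prod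

/-- `ω` is the infinite word associated with `x`: the ray from `i` towards `x` starts in `F`, and
for each `n` it finally leaves the tile `ω₀ ⋯ ωₙ₋₁ F` through the side labelled `ωₙ`, that is,
into the adjacent tile `ω₀ ⋯ ωₙ F`. -/
def IsExpansion (G : Subgroup SL(2, ℝ)) (x : OnePoint ℝ) (ω : ℕ → SL(2, ℝ)) : Prop :=
  ∃ r, IsRayTo r x ∧ ∀ n, ω n ∈ sidePairings G ∧
    ∃ t, IsGreatest {s | r s ∈ prefixProd ω n • dirichlet G} t ∧
      r t ∈ prefixProd ω (n + 1) • dirichlet G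

/-- The blocks of the word `ω`: the `k`-th block (counting from `k = 0`) consists of the letters
`ω m` with `N k ≤ m < N (k + 1)`. It is either a single hyperbolic letter or a maximal run of
one and the same parabolic letter. -/
def IsBlockDecomposition (ω : ℕ → SL(2, ℝ)) (N : ℕ → ℕ) : Prop :=
  N 0 = 0 ∧ ∀ k,
    ((ω (N k)).1.IsHyperbolic ∧ N (k + 1) = N k + 1) ∨
    ((ω (N k)).1.IsParabolic ∧ N k < N (k + 1) ∧
      (∀ m, N k ≤ m → m < N (k + 1) → ω m = ω (N k)) ∧ ω (N (k + 1)) ≠ ω (N k))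

/-- The cusp winding process: the length of the `k`-th block minus one. -/
def cuspWinding (N : ℕ → ℕ) (k : ℕ) : ℕ := N (k + 1) - N k - 1

/-- The level set of the mean cusp-winding number: the points of the radial limit set at which
`2 ∑_{k < n} log⁺ a_k / d(B_0 ⋯ B_{n-1}(i), i)` converges to `α` as `n → ∞`. -/
def levelSet (G : Subgroup SL(2, ℝ)) (α : ℝ) : Set (OnePoint ℝ) :=
  {x | x ∈ radialLimitSet G ∧ ∃ ω N, IsExpansion G x ω ∧ IsBlockDecomposition ω N ∧
    Tendsto (fun n : ℕ =>
      2 * (∑ k ∈ Finset.range n, Real.posLog (cuspWinding N k : ℝ)) /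
        dist (prefixProd ω (N n) • I) I) atTop (𝓝 α)}

/-- The symmetric set of all `h i`, `γ j` and their inverses. -/
def symmGenerators {u v : ℕ} (h : Fin u → SL(2, ℝ)) (γ : Fin v → SL(2, ℝ)) : Set SL(2, ℝ) :=
  {g | (∃ i, g = h i ∨ g = (h i)⁻¹) ∨ ∃ j, g = γ j ∨ g = (γ j)⁻¹}

end CuspWinding

/-! Along a geodesic parametrised by arc length, `cosh` of the distance to a fixed point is a
combination of `cosh` and `sinh`. A half-plane bounded by a bisector is therefore a sublevel set of
such a function (`gap`), and questions about a ray from `I` reduce to this: a combination that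
starts positive and becomes nonpositive is negative ever after.

Freeness enters through one combinatorial fact: the elements whose reduced word starts with a given
letter are joined to all others, in the Cayley graph of the side pairings, by a single edge. It
forces the sides of the Dirichlet domain to be complete geodesics (`mem_dirichlet_of_bisector`)
bounding disjoint half-planes (`gap_pos_of_gap_nonpos`). Hence half-planes along a reduced word are
nested, and words of boundary points are reduced.

Necessity of `α ≤ 1`: normalise a parabolic letter to `z ↦ z + 1`; the other sides then lie below
height `1 / 2`. So the geodesic from `I` to the orbit point reached after `n` blocks has, between
consecutive blocks, a point of height at most `1` in the charts of both neighbouring cusps. Winding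
`a + 1` times between two such points costs distance at least `2 log a`, with no additive loss.
Summing, only the two ends contribute a constant (`exists_sum_posLog_le`), and it disappears after
division by the displacement, which tends to infinity.

Sufficiency: use words `γ ^ n₀ δ γ ^ n₁ δ ⋯` with `γ` parabolic and all exponents at least `2`. Each
run of `γ` forces geodesics back near the orbit, so a limiting ray exists, is radial and has this
word (`exists_isExpansion`). Each pair of blocks lengthens the displacement by at most `2 log⁺ a +
C`. For `α < 1` a greedy choice between a large exponent and `2` keeps `2 ∑ log⁺ a - α d` bounded;
for `α = 1` the exponents grow so fast that the accumulated error, linear in the number of pairs, is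
negligible. -/

namespace CuspWinding

/-! ### Hyperbolic-linear functions -/

/-- Linear combinations of `cosh` and `sinh`: the restrictions of linear functionals of the
hyperboloid model to geodesics parametrised by arc length. -/
def HypLinear (f : ℝ → ℝ) : Prop := ∃ a b, ∀ t, f t = a * Real.cosh t + b * Real.sinh t

namespace HypLinear

variable {f g : ℝ → ℝ}

lemma sub (hf : HypLinear f) (hg : HypLinear g) : HypLinear fun t => f t - g t := by
  obtain ⟨a, b, h⟩ := hf
  obtain ⟨c, d, k⟩ := hg
  exact ⟨a - c, b - d, fun t => by simp only [h, k]; ring⟩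

lemma const_mul (hf : HypLinear f) (c : ℝ) : HypLinear fun t => c * f t := by
  obtain ⟨a, b, h⟩ := hf
  exact ⟨c * a, c * b, fun t => by simp only [h]; ring⟩

lemma continuous (hf : HypLinear f) : Continuous f := by
  obtain ⟨a, b, h⟩ := hf
  rw [funext h]
  exact (continuous_const.mul Real.continuous_cosh).add (continuous_const.mul Real.continuous_sinh)

/-- The solutions of `f'' = f` form a plane, so two values determine a third. For `t₁ ≤ t ≤ t₂` all
coefficients are nonnegative, which is what transfers signs between the three points. -/
lemma three_point (hf : HypLinear f) (t₁ t t₂ : ℝ) :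
    Real.sinh (t₂ - t₁) * f t = Real.sinh (t₂ - t) * f t₁ + Real.sinh (t - t₁) * f t₂ := by
  obtain ⟨a, b, h⟩ := hf
  simp only [h, Real.sinh_sub]
  have h1 := Real.cosh_sq t
  have h2 := Real.cosh_sq t₁
  have h3 := Real.cosh_sq t₂
  ring

/-- Once nonpositive, a hyperbolic-linear function that starts positive is negative. -/
lemma neg_of_pos_of_nonpos (hf : HypLinear f) {t₀ t₁ t : ℝ} (h₀ : 0 < f t₀) (h01 : t₀ ≤ t₁)
    (h₁ : f t₁ ≤ 0) (ht : t₁ < t) : f t < 0 := by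
  have h01' : t₀ < t₁ := lt_of_le_of_ne h01 (by rintro rfl; linarith)
  have key := hf.three_point t₀ t₁ t
  have s1 : 0 < Real.sinh (t - t₀) := Real.sinh_pos_iff.2 (by linarith)
  have s2 : 0 < Real.sinh (t - t₁) := Real.sinh_pos_iff.2 (by linarith)
  have s3 : 0 < Real.sinh (t₁ - t₀) := Real.sinh_pos_iff.2 (by linarith)
  have : Real.sinh (t₁ - t₀) * f t < 0 := by nlinarith [mul_pos s2 h₀]
  exact (pos_iff_neg_of_mul_neg this).1 s3

lemma eq_of_zero (hf : HypLinear f) {t₀ t₁ t₂ : ℝ} (h₀ : 0 < f t₀) (h01 : t₀ ≤ t₁) (h02 : t₀ ≤ t₂)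
    (h₁ : f t₁ = 0) (h₂ : f t₂ = 0) : t₁ = t₂ := by
  rcases lt_trichotomy t₁ t₂ with h | h | h
  · exact absurd (hf.neg_of_pos_of_nonpos h₀ h01 h₁.le h) (by simp [h₂])
  · exact h
  · exact absurd (hf.neg_of_pos_of_nonpos h₀ h02 h₂.le h) (by simp [h₁])

/-- Beyond a zero, a hyperbolic-linear function keeps its sign. -/
lemma neg_of_zero_of_neg (hf : HypLinear f) {t₀ s t : ℝ} (h₀ : f t₀ = 0) (hs : t₀ < s)
    (hfs : f s < 0) (ht : t₀ < t) : f t < 0 := by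
  have key := hf.three_point t₀ t s
  rw [h₀, mul_zero, zero_add] at key
  have s1 : 0 < Real.sinh (s - t₀) := Real.sinh_pos_iff.2 (by linarith)
  have s2 : 0 < Real.sinh (t - t₀) := Real.sinh_pos_iff.2 (by linarith)
  have : Real.sinh (s - t₀) * f t < 0 := by
    rw [key]
    exact mul_neg_of_pos_of_neg s2 hfs
  exact (pos_iff_neg_of_mul_neg this).1 s1

/-- Source of the convexity of half-planes, hence of tiles. -/
lemma nonpos_of_mem_Icc (hf : HypLinear f) {t₁ t t₂ : ℝ} (h₁ : f t₁ ≤ 0) (h₂ : f t₂ ≤ 0)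
    (h1 : t₁ ≤ t) (h2 : t ≤ t₂) : f t ≤ 0 := by
  rcases eq_or_lt_of_le (h1.trans h2) with h | h
  · obtain rfl : t = t₁ := by linarith
    exact h₁
  have key := hf.three_point t₁ t t₂
  have s1 : 0 < Real.sinh (t₂ - t₁) := Real.sinh_pos_iff.2 (by linarith)
  have s2 : 0 ≤ Real.sinh (t₂ - t) := Real.sinh_nonneg_iff.2 (by linarith)
  have s3 : 0 ≤ Real.sinh (t - t₁) := Real.sinh_nonneg_iff.2 (by linarith)
  have : Real.sinh (t₂ - t₁) * f t ≤ 0 := by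
    rw [key]
    exact add_nonpos (mul_nonpos_of_nonneg_of_nonpos s2 h₁)
      (mul_nonpos_of_nonneg_of_nonpos s3 h₂)
  exact nonpos_of_mul_nonpos_right this s1

end HypLinear

/-! ### Hyperboloid and polar coordinates -/

/-- The second coordinate in the hyperboloid model; the first one is `cosh (dist I z)`. -/
noncomputable def hypX (z : ℍ) : ℝ := (z.re ^ 2 + z.im ^ 2 - 1) / (2 * z.im)

/-- The third coordinate in the hyperboloid model. -/
noncomputable def hypY (z : ℍ) : ℝ := z.re / z.im

lemma cosh_dist_eq (z w : ℍ) : Real.cosh (dist z w) =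
    1 + ((z.re - w.re) ^ 2 + (z.im - w.im) ^ 2) / (2 * z.im * w.im) := by
  rw [UpperHalfPlane.cosh_dist, Complex.dist_eq_re_im, Real.sq_sqrt (by positivity)]
  rfl

lemma cosh_dist_I (z : ℍ) : Real.cosh (dist I z) = (z.re ^ 2 + z.im ^ 2 + 1) / (2 * z.im) := by
  have := z.im_pos
  rw [cosh_dist_eq]
  simp only [I_re, I_im]
  field_simp
  ring

lemma hypX_sq_add_hypY_sq (z : ℍ) : hypX z ^ 2 + hypY z ^ 2 = Real.sinh (dist I z) ^ 2 := by
  have := z.im_pos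
  rw [Real.sinh_sq, cosh_dist_I, hypX, hypY]
  field_simp
  ring

/-- The difference of the first two hyperboloid coordinates is `1 / im`; the third then recovers the
real part. -/
lemma eq_of_hyp_eq {z w : ℍ} (h₀ : Real.cosh (dist I z) = Real.cosh (dist I w))
    (h₁ : hypX z = hypX w) (h₂ : hypY z = hypY w) : z = w := by
  have hz := z.im_pos
  have hw := w.im_pos
  have e (u : ℍ) : Real.cosh (dist I u) - hypX u = u.im⁻¹ := by
    have := u.im_pos
    rw [cosh_dist_I, hypX]
    field_simp
    ring
  have him : z.im = w.im := inv_injective (by rw [← e z, ← e w, h₀, h₁])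
  refine UpperHalfPlane.ext_re_im ?_ him
  rw [hypY, hypY, him] at h₂
  field_simp at h₂
  exact h₂

lemma cosh_sub_sinh_mul_cos_pos (t φ : ℝ) : 0 < Real.cosh t - Real.sinh t * Real.cos φ := by
  have h1 : |Real.sinh t * Real.cos φ| < Real.cosh t := by
    rw [abs_mul]
    calc |Real.sinh t| * |Real.cos φ| ≤ |Real.sinh t| * 1 :=
          mul_le_mul_of_nonneg_left (Real.abs_cos_le_one φ) (abs_nonneg _)
      _ = |Real.sinh t| := mul_one _
      _ < Real.cosh t := abs_lt_of_sq_lt_sq (by linarith [Real.cosh_sq t]) (Real.cosh_pos t).le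
  linarith [(abs_lt.1 h1).2]

/-- The point at signed distance `t` from `I` in the direction `φ`. -/
noncomputable def polar (t φ : ℝ) : ℍ :=
  ⟨⟨Real.sinh t * Real.sin φ / (Real.cosh t - Real.sinh t * Real.cos φ),
    (Real.cosh t - Real.sinh t * Real.cos φ)⁻¹⟩, inv_pos.2 (cosh_sub_sinh_mul_cos_pos t φ)⟩

lemma polar_re (t φ : ℝ) : (polar t φ).re =
    Real.sinh t * Real.sin φ / (Real.cosh t - Real.sinh t * Real.cos φ) := rfl

lemma polar_im (t φ : ℝ) : (polar t φ).im = (Real.cosh t - Real.sinh t * Real.cos φ)⁻¹ := rfl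

/-- Minus the Lorentzian product of `w` with `(cosh t, sinh t cos φ, sinh t sin φ)`. Its linearity
in `cosh t` and `sinh t` is what makes all bisectors tractable along rays. -/
lemma cosh_dist_polar (t φ : ℝ) (w : ℍ) : Real.cosh (dist (polar t φ) w) =
    Real.cosh t * Real.cosh (dist I w)
      - Real.sinh t * (Real.cos φ * hypX w + Real.sin φ * hypY w) := by
  have hw := w.im_pos
  have hp := cosh_sub_sinh_mul_cos_pos t φ
  rw [cosh_dist_eq, cosh_dist_I, hypX, hypY, polar_re, polar_im]
  have hs : Real.sinh t ^ 2 * Real.sin φ ^ 2 =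
      Real.cosh t ^ 2 - 1 - Real.sinh t ^ 2 * Real.cos φ ^ 2 := by
    rw [Real.cosh_sq, Real.sin_sq]; ring
  field_simp
  ring_nf
  rw [hs]
  ring

lemma polar_zero (φ : ℝ) : polar 0 φ = I :=
  UpperHalfPlane.ext_re_im (by simp [polar_re]) (by simp [polar_im])

lemma hypX_polar (t φ : ℝ) : hypX (polar t φ) = Real.sinh t * Real.cos φ := by
  have hp := cosh_sub_sinh_mul_cos_pos t φ
  have hs : Real.sinh t ^ 2 * Real.sin φ ^ 2 =
      Real.cosh t ^ 2 - 1 - Real.sinh t ^ 2 * Real.cos φ ^ 2 := by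
    rw [Real.cosh_sq, Real.sin_sq]; ring
  rw [hypX, polar_re, polar_im]
  field_simp
  rw [hs]
  ring

lemma hypY_polar (t φ : ℝ) : hypY (polar t φ) = Real.sinh t * Real.sin φ := by
  have hp := cosh_sub_sinh_mul_cos_pos t φ
  rw [hypY, polar_re, polar_im]
  field_simp

lemma dist_I_polar (t φ : ℝ) : dist I (polar t φ) = |t| := by
  have h := cosh_dist_polar t φ I
  rw [dist_comm] at h
  refine Real.cosh_strictMonoOn.injOn (Set.mem_Ici.2 dist_nonneg) (Set.mem_Ici.2 (abs_nonneg t)) ?_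
  simpa [hypX, hypY] using h

lemma dist_polar_polar (s t φ : ℝ) : dist (polar s φ) (polar t φ) = |s - t| := by
  refine Real.cosh_strictMonoOn.injOn (Set.mem_Ici.2 dist_nonneg)
    (Set.mem_Ici.2 (abs_nonneg _)) ?_
  rw [cosh_dist_polar, dist_I_polar, hypX_polar, hypY_polar, Real.cosh_abs, Real.cosh_abs,
    Real.cosh_sub]
  linear_combination (-Real.sinh s * Real.sinh t) * Real.cos_sq_add_sin_sq φ

/-- The angle is the argument of `hypX z + i hypY z`. Confining it to a compact interval later
allows a limiting direction to be extracted. -/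
lemma exists_eq_polar (z : ℍ) : ∃ φ ∈ Set.Icc (-Real.pi) Real.pi, z = polar (dist I z) φ := by
  set w : ℂ := ⟨hypX z, hypY z⟩
  have hs : 0 ≤ Real.sinh (dist I z) := Real.sinh_nonneg_iff.2 dist_nonneg
  have hw : ‖w‖ = Real.sinh (dist I z) := by
    rw [← Real.sqrt_sq hs, ← hypX_sq_add_hypY_sq, Complex.norm_def, Complex.normSq_apply]
    congr 1
    simp only [w]
    ring
  refine ⟨w.arg, ⟨(Complex.neg_pi_lt_arg w).le, Complex.arg_le_pi w⟩, eq_of_hyp_eq ?_ ?_ ?_⟩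
  · rw [dist_I_polar, Real.cosh_abs]
  · rw [hypX_polar, ← hw]; exact (Complex.norm_mul_cos_arg w).symm
  · rw [hypY_polar, ← hw]; exact (Complex.norm_mul_sin_arg w).symm

lemma continuous_polar : Continuous fun p : ℝ × ℝ => polar p.1 p.2 := by
  have h : Continuous fun p : ℝ × ℝ => Real.cosh p.1 - Real.sinh p.1 * Real.cos p.2 := by fun_prop
  have h0 (p : ℝ × ℝ) : Real.cosh p.1 - Real.sinh p.1 * Real.cos p.2 ≠ 0 :=
    (cosh_sub_sinh_mul_cos_pos p.1 p.2).ne'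
  rw [UpperHalfPlane.isEmbedding_coe.continuous_iff]
  have e : ((↑) : ℍ → ℂ) ∘ (fun p : ℝ × ℝ => polar p.1 p.2) = fun p : ℝ × ℝ =>
      Complex.equivRealProdCLM.symm
        (Real.sinh p.1 * Real.sin p.2 / (Real.cosh p.1 - Real.sinh p.1 * Real.cos p.2),
        (Real.cosh p.1 - Real.sinh p.1 * Real.cos p.2)⁻¹) := by
    funext p
    apply Complex.ext <;> simp [polar]
  rw [e]
  refine Complex.equivRealProdCLM.symm.continuous.comp ?_
  exact ((by fun_prop : Continuous fun p : ℝ × ℝ => Real.sinh p.1 * Real.sin p.2).div h h0).prodMk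
    (h.inv₀ h0)

lemma continuous_polar_left (φ : ℝ) : Continuous fun t => polar t φ :=
  continuous_polar.comp (continuous_id.prodMk continuous_const)

lemma hypLinear_cosh_dist_polar (φ : ℝ) (w : ℍ) :
    HypLinear fun t => Real.cosh (dist (polar t φ) w) :=
  ⟨Real.cosh (dist I w), -(Real.cos φ * hypX w + Real.sin φ * hypY w), fun t => by
    simp only [cosh_dist_polar]; ring⟩

/-! ### Bisectors -/

/-- A function, linear in the hyperboloid model, that is nonpositive exactly on the closed half-plane
of the points `z` at least as close to `q` as to `p`. -/
noncomputable def gap (p q z : ℍ) : ℝ := Real.cosh (dist z q) - Real.cosh (dist z p)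

lemma cosh_dist_le_iff {a b c d : ℍ} :
    Real.cosh (dist a b) ≤ Real.cosh (dist c d) ↔ dist a b ≤ dist c d := by
  rw [Real.cosh_le_cosh, abs_of_nonneg dist_nonneg, abs_of_nonneg dist_nonneg]

lemma gap_nonpos_iff {p q z : ℍ} : gap p q z ≤ 0 ↔ dist z q ≤ dist z p := by
  rw [gap, sub_nonpos, cosh_dist_le_iff]

lemma gap_nonneg_iff {p q z : ℍ} : 0 ≤ gap p q z ↔ dist z p ≤ dist z q := by
  rw [gap, sub_nonneg, cosh_dist_le_iff]

lemma gap_pos_iff {p q z : ℍ} : 0 < gap p q z ↔ dist z p < dist z q := by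
  rw [← not_le, gap_nonpos_iff, not_le]

lemma gap_neg_iff {p q z : ℍ} : gap p q z < 0 ↔ dist z q < dist z p := by
  rw [← not_le, gap_nonneg_iff, not_le]

lemma gap_eq_zero_iff {p q z : ℍ} : gap p q z = 0 ↔ dist z p = dist z q := by
  rw [le_antisymm_iff, gap_nonpos_iff, gap_nonneg_iff, le_antisymm_iff, and_comm]

lemma gap_swap (p q z : ℍ) : gap q p z = -gap p q z := by
  rw [gap, gap, neg_sub]

lemma gap_smul (g : SL(2, ℝ)) (p q z : ℍ) : gap (g • p) (g • q) (g • z) = gap p q z := by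
  rw [gap, gap, dist_smul, dist_smul]

lemma gap_smul' (g : SL(2, ℝ)) (p q z : ℍ) : gap (g • p) (g • q) z = gap p q (g⁻¹ • z) := by
  rw [← gap_smul g p q, smul_inv_smul]

lemma continuous_gap (p q : ℍ) : Continuous (gap p q) :=
  (Real.continuous_cosh.comp (continuous_id.dist continuous_const)).sub
    (Real.continuous_cosh.comp (continuous_id.dist continuous_const))

lemma hypLinear_gap_polar (p q : ℍ) (φ : ℝ) : HypLinear fun t => gap p q (polar t φ) :=
  (hypLinear_cosh_dist_polar φ q).sub (hypLinear_cosh_dist_polar φ p)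

/-- Through every point of a bisector there passes a geodesic line contained in it. -/
lemma exists_bisector_line {z p q : ℍ} (h : dist z p = dist z q) :
    ∃ σ : ℝ → ℍ, Continuous σ ∧ Function.Injective σ ∧ σ 0 = z ∧
      (∀ t, dist (σ t) p = dist (σ t) q) ∧ ∀ w, HypLinear fun t => Real.cosh (dist (σ t) w) := by
  obtain ⟨g, rfl⟩ := MulAction.exists_smul_eq SL(2, ℝ) I z
  set p' := g⁻¹ • p
  set q' := g⁻¹ • q
  have hd (w u : ℍ) : dist (g • u) w = dist u (g⁻¹ • w) := by
    rw [← dist_smul g u, smul_inv_smul]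
  -- With `z` moved to `I`, the line must leave `I` orthogonally to the difference of the `(hypX,
  -- hypY)` vectors of `p'` and `q'`; hence the quarter turn in `w`.
  obtain ⟨φ, hφ⟩ : ∃ φ, Real.cos φ * (hypX p' - hypX q') + Real.sin φ * (hypY p' - hypY q') = 0 := by
    set w : ℂ := ⟨-(hypY p' - hypY q'), hypX p' - hypX q'⟩
    rcases eq_or_ne w 0 with hw | hw
    · have h1 := congrArg Complex.re hw
      have h2 := congrArg Complex.im hw
      simp only [w, Complex.zero_re, Complex.zero_im, neg_eq_zero] at h1 h2
      exact ⟨0, by rw [h1, h2]; ring⟩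
    · refine ⟨w.arg, ?_⟩
      have hn : ‖w‖ ≠ 0 := norm_ne_zero_iff.2 hw
      rw [Complex.cos_arg hw, Complex.sin_arg]
      simp only [w]
      ring
  refine ⟨fun t => g • polar t φ, (continuous_polar_left φ).const_smul g, ?_, ?_, ?_, ?_⟩
  · intro s t hst
    have h1 : polar s φ = polar t φ := by simpa using hst
    have h2 := dist_polar_polar s t φ
    rw [h1, dist_self] at h2
    linarith [abs_eq_zero.1 h2.symm]
  · simp [polar_zero]
  · intro t
    rw [hd, hd] at h ⊢
    rw [← gap_eq_zero_iff, gap, cosh_dist_polar, cosh_dist_polar]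
    change dist I p' = dist I q' at h
    rw [h]
    linear_combination Real.sinh t * hφ
  · intro w
    simp only [hd]
    exact hypLinear_cosh_dist_polar φ _

/-- Two distinct circles with distinct centres have at most two points in common. -/
lemma eq_or_eq_of_equidistant {z z' p q r : ℍ} (hz : z ≠ z') (h1 : dist z p = dist z q)
    (h2 : dist z p = dist z r) (h1' : dist z' p = dist z' q) (h2' : dist z' p = dist z' r) :
    p = q ∨ p = r ∨ q = r := by
  obtain ⟨g, rfl⟩ := MulAction.exists_smul_eq SL(2, ℝ) I z
  have hd (w u : ℍ) : dist u w = dist (g⁻¹ • u) (g⁻¹ • w) := by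
    rw [dist_smul]
  have hsub : g⁻¹ • p = g⁻¹ • q ∨ g⁻¹ • p = g⁻¹ • r ∨ g⁻¹ • q = g⁻¹ • r →
      p = q ∨ p = r ∨ q = r := by simp
  apply hsub
  rw [hd p, hd q, inv_smul_smul] at h1
  rw [hd p, hd r, inv_smul_smul] at h2
  rw [hd p, hd q] at h1'
  rw [hd p, hd r] at h2'
  have hz' : I ≠ g⁻¹ • z' := by
    rintro h
    exact hz (by rw [h, smul_inv_smul])
  generalize g⁻¹ • p = p at *
  generalize g⁻¹ • q = q at *
  generalize g⁻¹ • r = r at *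
  generalize g⁻¹ • z' = u at *
  obtain ⟨φ, -, hu⟩ := exists_eq_polar u
  have ht : 0 < Real.sinh (dist I u) := Real.sinh_pos_iff.2 (dist_pos.2 hz')
  have key (w : ℍ) (hw : dist I p = dist I w) (hw' : dist u p = dist u w) :
      Real.cos φ * hypX p + Real.sin φ * hypY p = Real.cos φ * hypX w + Real.sin φ * hypY w := by
    have e1 := cosh_dist_polar (dist I u) φ p
    have e2 := cosh_dist_polar (dist I u) φ w
    rw [← hu] at e1 e2
    rw [hw', e2, ← hw] at e1
    have : Real.sinh (dist I u) * ((Real.cos φ * hypX p + Real.sin φ * hypY p) -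
        (Real.cos φ * hypX w + Real.sin φ * hypY w)) = 0 := by linear_combination e1
    rcases mul_eq_zero.1 this with h | h
    · exact absurd h ht.ne'
    · linarith
  have kq := key q h1 h1'
  have kr := key r h2 h2'
  have sp := hypX_sq_add_hypY_sq p
  have sq := hypX_sq_add_hypY_sq q
  have sr := hypX_sq_add_hypY_sq r
  rw [← h1] at sq
  rw [← h2] at sr
  have cs := Real.cos_sq_add_sin_sq φ
  set c := Real.cos φ
  set s := Real.sin φ
  have sqn (w : ℍ) (hw : c * hypX p + s * hypY p = c * hypX w + s * hypY w)
      (hs : hypX w ^ 2 + hypY w ^ 2 = Real.sinh (dist I p) ^ 2) :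
      (c * hypY w - s * hypX w) ^ 2 = (c * hypY p - s * hypX p) ^ 2 := by
    have e (v : ℍ) : (c * hypY v - s * hypX v) ^ 2 =
        (hypX v ^ 2 + hypY v ^ 2) - (c * hypX v + s * hypY v) ^ 2 := by
      linear_combination (hypX v ^ 2 + hypY v ^ 2) * cs
    rw [e, e, hs, sp, hw]
  have fin (v w : ℍ) (h0 : dist I v = dist I w)
      (h : c * hypX v + s * hypY v = c * hypX w + s * hypY w)
      (h' : c * hypY v - s * hypX v = c * hypY w - s * hypX w) : v = w := by
    refine eq_of_hyp_eq (by rw [h0]) ?_ ?_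
    · linear_combination c * h - s * h' + (hypX w - hypX v) * cs
    · linear_combination s * h + c * h' + (hypY w - hypY v) * cs
  -- In the frame rotated by `φ`, the three centres share one component and agree up to sign in the
  -- other; among three signs two coincide.
  rcases sq_eq_sq_iff_eq_or_eq_neg.1 (sqn q kq sq) with hq | hq
  · exact Or.inl (fin p q h1 kq hq.symm)
  rcases sq_eq_sq_iff_eq_or_eq_neg.1 (sqn r kr sr) with hr | hr
  · exact Or.inr (Or.inl (fin p r h2 kr hr.symm))
  · exact Or.inr (Or.inr (fin q r (h1.symm.trans h2) (kq.symm.trans kr) (hq.trans hr.symm)))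

end CuspWinding

/-! ### Sides of the Dirichlet domain and the tree structure of the tessellation -/

namespace CuspWinding

/-- The part of the hypotheses on `G` from which the tree structure of the tessellation follows:
every side pairing `s` splits `G` into two parts which are connected, in the Cayley graph of the
side pairings, by the edge between `1` and `s` only. -/
structure IsTreeLike (G : Subgroup SL(2, ℝ)) : Prop where
  finite_sidePairings : (sidePairings G).Finite
  finite_ball : ∀ R : ℝ, {g | g ∈ G ∧ dist I (g • I) ≤ R}.Finite
  eq_one_of_smul_I : ∀ g ∈ G, g • I = I → g = 1
  inv_mem : ∀ s ∈ sidePairings G, s⁻¹ ∈ sidePairings G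
  exists_cut : ∀ s ∈ sidePairings G, ∃ B : Set SL(2, ℝ), s ∈ B ∧ 1 ∉ B ∧
    ∀ g ∈ G, ∀ t ∈ sidePairings G, g ∈ B → g * t ∉ B → g = s ∧ t = s⁻¹

variable {G : Subgroup SL(2, ℝ)}

lemma mem_smul_dirichlet {g : SL(2, ℝ)} (hg : g ∈ G) {z : ℍ} :
    z ∈ g • dirichlet G ↔ ∀ k ∈ G, dist z (g • I) ≤ dist z (k • I) := by
  have e (k : SL(2, ℝ)) : dist (g⁻¹ • z) (k • I) = dist z ((g * k) • I) := by
    rw [← dist_smul g, smul_inv_smul, mul_smul]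
  rw [Set.mem_smul_set_iff_inv_smul_mem]
  constructor
  · intro h k hk
    have := h (g⁻¹ * k) (G.mul_mem (G.inv_mem hg) hk)
    rw [e, mul_inv_cancel_left] at this
    refine le_trans (le_of_eq ?_) this
    rw [← dist_smul g⁻¹ z, inv_smul_smul]
  · intro h k hk
    rw [e]
    refine le_trans (le_of_eq ?_) (h _ (G.mul_mem hg hk))
    rw [← dist_smul g⁻¹ z, inv_smul_smul]

lemma polar_congr {τ τ' φ φ' : ℝ} (hτ : 0 ≤ τ) (hτ' : 0 ≤ τ') (h : polar τ φ = polar τ' φ')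
    (hI : polar τ φ ≠ I) (t : ℝ) : polar t φ = polar t φ' := by
  have e : τ = τ' := by
    have := congrArg (dist I) h
    rwa [dist_I_polar, dist_I_polar, abs_of_nonneg hτ, abs_of_nonneg hτ'] at this
  subst e
  have hs : Real.sinh τ ≠ 0 := by
    intro h0
    rw [Real.sinh_eq_zero] at h0
    exact hI (by rw [h0, polar_zero])
  have h1 := congrArg hypX h
  have h2 := congrArg hypY h
  rw [hypX_polar, hypX_polar, mul_right_inj' hs] at h1
  rw [hypY_polar, hypY_polar, mul_right_inj' hs] at h2
  refine UpperHalfPlane.ext_re_im ?_ ?_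
  · rw [polar_re, polar_re, h1, h2]
  · rw [polar_im, polar_im, h1]

/-- The geodesic segment from `I` to `z`. -/
def segI (z : ℍ) : Set ℍ :=
  {w | ∃ φ, z = polar (dist I z) φ ∧ ∃ τ ∈ Set.Icc 0 (dist I z), polar τ φ = w}

lemma isPreconnected_segI (z : ℍ) : IsPreconnected (segI z) := by
  obtain ⟨φ, -, hφ⟩ := exists_eq_polar z
  have : segI z = (fun t => polar t φ) '' Set.Icc 0 (dist I z) := by
    ext w
    constructor
    · rintro ⟨ψ, hψ, τ, hτ, rfl⟩
      rcases eq_or_ne z I with rfl | hz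
      · rw [dist_self] at hτ ⊢
        obtain rfl : τ = 0 := le_antisymm hτ.2 hτ.1
        exact ⟨0, by simp, by simp [polar_zero]⟩
      · exact ⟨τ, hτ, polar_congr dist_nonneg dist_nonneg (hφ.symm.trans hψ)
          (by rwa [← hφ]) τ⟩
    · rintro ⟨τ, hτ, rfl⟩
      exact ⟨φ, hφ, τ, hτ, rfl⟩
  rw [this]
  exact isPreconnected_Icc.image _ (continuous_polar_left φ).continuousOn

lemma I_mem_segI (z : ℍ) : I ∈ segI z := by
  obtain ⟨φ, -, hφ⟩ := exists_eq_polar z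
  exact ⟨φ, hφ, 0, by simp, polar_zero φ⟩

lemma self_mem_segI (z : ℍ) : z ∈ segI z := by
  obtain ⟨φ, -, hφ⟩ := exists_eq_polar z
  exact ⟨φ, hφ, dist I z, by simp, hφ.symm⟩

lemma gap_self_pos {p q : ℍ} (h : p ≠ q) : 0 < gap p q p := by
  rw [gap_pos_iff, dist_self]
  exact dist_pos.2 h

/-- Segments from `I` to different points of a bisector of `I` meet only at `I`. -/
lemma eq_of_mem_segI {q z z' w : ℍ} (hq : I ≠ q) (hz : dist z I = dist z q)
    (hz' : dist z' I = dist z' q) (hw : w ∈ segI z) (hw' : w ∈ segI z') (hI : w ≠ I) : z = z' := by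
  obtain ⟨φ, h1, τ, hτ, rfl⟩ := hw
  obtain ⟨ψ, h2, τ', hτ', h3⟩ := hw'
  have hc := polar_congr hτ.1 hτ'.1 h3.symm hI
  rw [← hc] at h2
  rw [h1, h2]
  congr 1
  refine (hypLinear_gap_polar I q φ).eq_of_zero (t₀ := 0) ?_ dist_nonneg dist_nonneg ?_ ?_
  · rw [polar_zero]; exact gap_self_pos hq
  · rw [← h1, gap_eq_zero_iff, hz]
  · rw [← h2, gap_eq_zero_iff, hz']

lemma eq_of_mem_segI_of_bisector {q z w : ℍ} (hq : I ≠ q) (hz : dist z I = dist z q)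
    (hw : w ∈ segI z) (hw' : dist w I = dist w q) : w = z := by
  refine eq_of_mem_segI hq hw' hz (self_mem_segI w) hw ?_
  rintro rfl
  rw [dist_self] at hw'
  exact hq (dist_eq_zero.1 hw'.symm)

lemma isClosed_dirichlet (G : Subgroup SL(2, ℝ)) : IsClosed (dirichlet G) := by
  have : dirichlet G = ⋂ g ∈ G, {z | dist z I ≤ dist z (g • I)} := by
    ext z; simp [dirichlet]
  rw [this]
  exact isClosed_biInter fun g _ =>
    isClosed_le (continuous_id.dist continuous_const) (continuous_id.dist continuous_const)

namespace IsTreeLike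

variable (hG : IsTreeLike G)
include hG

lemma eq_of_smul_I_eq {g k : SL(2, ℝ)} (hg : g ∈ G) (hk : k ∈ G) (h : g • I = k • I) : g = k := by
  have := hG.eq_one_of_smul_I (k⁻¹ * g) (G.mul_mem (G.inv_mem hk) hg)
    (by rw [mul_smul, h, inv_smul_smul])
  exact (inv_mul_eq_one.1 this).symm

lemma finite_dist_le (z : ℍ) (R : ℝ) : {g | g ∈ G ∧ dist z (g • I) ≤ R}.Finite := by
  refine (hG.finite_ball (dist I z + R)).subset ?_
  rintro g ⟨hg, h⟩
  exact ⟨hg, (dist_triangle _ z _).trans (by linarith)⟩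

lemma countable : (G : Set SL(2, ℝ)).Countable := by
  have : (G : Set SL(2, ℝ)) ⊆ ⋃ n : ℕ, {g | g ∈ G ∧ dist I (g • I) ≤ n} := by
    intro g hg
    obtain ⟨n, hn⟩ := exists_nat_ge (dist I (g • I))
    exact Set.mem_iUnion.2 ⟨n, hg, hn⟩
  exact (Set.countable_iUnion fun n : ℕ => (hG.finite_ball n).countable).mono this

lemma exists_infDist_eq {S : Set SL(2, ℝ)} (hS : S ⊆ G) (hne : S.Nonempty) (z : ℍ) :
    ∃ g ∈ S, Metric.infDist z ((· • I) '' S) = dist z (g • I) := by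
  obtain ⟨g₀, hg₀⟩ := hne
  have hfin : {g | g ∈ S ∧ dist z (g • I) ≤ dist z (g₀ • I)}.Finite :=
    (hG.finite_dist_le z (dist z (g₀ • I))).subset fun g hg => ⟨hS hg.1, hg.2⟩
  obtain ⟨g, hg, hmin⟩ := Set.exists_min_image _ (fun g => dist z (g • I)) hfin ⟨g₀, hg₀, le_rfl⟩
  refine ⟨g, hg.1, le_antisymm (Metric.infDist_le_dist_of_mem ⟨g, hg.1, rfl⟩) ?_⟩
  have hne : ((· • I) '' S : Set ℍ).Nonempty := ⟨g₀ • I, g₀, hg₀, rfl⟩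
  refine (Metric.le_infDist hne).2 ?_
  rintro _ ⟨k, hk, rfl⟩
  rcases le_total (dist z (k • I)) (dist z (g₀ • I)) with h | h
  · exact hmin k ⟨hk, h⟩
  · exact hg.2.trans h

lemma smul_I_ne {s : SL(2, ℝ)} (hs : s ∈ sidePairings G) : I ≠ s • I :=
  fun h => hs.2.1 (hG.eq_one_of_smul_I s hs.1 h.symm)

/-- The bisector belonging to a side pairing is contained in the Dirichlet domain, so that the
sides of the Dirichlet domain are complete geodesic lines. -/
theorem mem_dirichlet_of_bisector {s : SL(2, ℝ)} (hs : s ∈ sidePairings G) {z : ℍ}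
    (hz : dist z I = dist z (s • I)) : z ∈ dirichlet G := by
  -- Otherwise an open, hence uncountable, set of points of the bisector line misses the Dirichlet
  -- domain. Each will yield a point where two tiles meet in that point alone, and such points are
  -- countable.
  by_contra hzF
  obtain ⟨B, hsB, h1B, hcut⟩ := hG.exists_cut s hs
  obtain ⟨σ, hσc, hσi, rfl, hσb, -⟩ := exists_bisector_line hz
  have hIs : I ≠ s • I := hG.smul_I_ne hs
  have hIs' : I ≠ s⁻¹ • I := hG.smul_I_ne (hG.inv_mem s hs)
  set S₁ : Set SL(2, ℝ) := G ∩ B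
  set S₂ : Set SL(2, ℝ) := G \ B
  have hS₁ : S₁ ⊆ G := Set.inter_subset_left
  have hS₂ : S₂ ⊆ G := Set.sdiff_subset
  have hs₁ : s ∈ S₁ := ⟨hs.1, hsB⟩
  have h1₂ : (1 : SL(2, ℝ)) ∈ S₂ := ⟨G.one_mem, h1B⟩
  set D : Set ℍ := {d | ∃ g ∈ G, ∃ k ∈ G, d ∈ g • dirichlet G ∩ k • dirichlet G ∧
    (g • dirichlet G ∩ k • dirichlet G).Subsingleton}
  have hD : D.Countable := by
    have : D = ⋃ g ∈ G, ⋃ k ∈ G, {d | d ∈ g • dirichlet G ∩ k • dirichlet G ∧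
        (g • dirichlet G ∩ k • dirichlet G).Subsingleton} := by
      ext d; simp only [D, Set.mem_iUnion, Set.mem_ofPred_eq, exists_prop]
    rw [this]
    refine hG.countable.biUnion fun g _ => hG.countable.biUnion fun k _ => ?_
    refine Set.Subsingleton.countable ?_
    rintro a ⟨ha, hsub⟩ b ⟨hb, -⟩
    exact hsub ha hb
  have hsinv (t : ℝ) : dist (s⁻¹ • σ t) I = dist (s⁻¹ • σ t) (s⁻¹ • I) := by
    rw [dist_smul, ← dist_smul s, smul_inv_smul, hσb]
  have key (t : ℝ) (ht : σ t ∉ dirichlet G) :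
      ∃ d ∈ D, (d ≠ I ∧ d ∈ segI (σ t)) ∨ (s⁻¹ • d ≠ I ∧ s⁻¹ • d ∈ segI (s⁻¹ • σ t)) := by
    -- A broken path from `I` through `σ t` to `s • I`. It starts in the orbit of `S₂` and ends in
    -- that of `S₁`, so some point of it is equally far from both; there a tile of `S₁` meets a tile
    -- of `S₂`.
    set C : Set ℍ := segI (σ t) ∪ (s • ·) '' segI (s⁻¹ • σ t)
    have hC : IsPreconnected C := by
      refine IsPreconnected.union (σ t) (self_mem_segI _) ⟨_, self_mem_segI _, smul_inv_smul _ _⟩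
        (isPreconnected_segI _) ((isPreconnected_segI _).image _ (continuous_const_smul s).continuousOn)
    set f₁ : ℍ → ℝ := fun z => Metric.infDist z ((· • I) '' S₁)
    set f₂ : ℍ → ℝ := fun z => Metric.infDist z ((· • I) '' S₂)
    have hf₁ : Continuous f₁ := Metric.continuous_infDist_pt _
    have hf₂ : Continuous f₂ := Metric.continuous_infDist_pt _
    obtain ⟨d, hdC, hd1, hd2⟩ := isPreconnected_closed_iff.1 hC _ _ (isClosed_le hf₁ hf₂)
      (isClosed_le hf₂ hf₁) (fun z _ => le_total (f₁ z) (f₂ z))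
      ⟨s • I, Or.inr ⟨I, I_mem_segI _, rfl⟩, by
        change f₁ (s • I) ≤ f₂ (s • I)
        have : f₁ (s • I) = 0 := Metric.infDist_zero_of_mem ⟨s, hs₁, rfl⟩
        rw [this]; exact Metric.infDist_nonneg⟩
      ⟨I, Or.inl (I_mem_segI _), by
        change f₂ I ≤ f₁ I
        have : f₂ I = 0 := Metric.infDist_zero_of_mem ⟨1, h1₂, one_smul _ _⟩
        rw [this]; exact Metric.infDist_nonneg⟩
    have hd : f₁ d = f₂ d := le_antisymm hd1 hd2
    obtain ⟨g, hg, hgd⟩ := hG.exists_infDist_eq hS₁ ⟨s, hs₁⟩ d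
    obtain ⟨k, hk, hkd⟩ := hG.exists_infDist_eq hS₂ ⟨1, h1₂⟩ d
    change f₁ d = _ at hgd
    change f₂ d = _ at hkd
    have hmin (m : SL(2, ℝ)) (hm : m ∈ G) : f₁ d ≤ dist d (m • I) := by
      by_cases hmB : m ∈ B
      · exact Metric.infDist_le_dist_of_mem ⟨m, ⟨hm, hmB⟩, rfl⟩
      · rw [hd]; exact Metric.infDist_le_dist_of_mem ⟨m, ⟨hm, hmB⟩, rfl⟩
    have hdg : d ∈ g • dirichlet G :=
      (mem_smul_dirichlet (hS₁ hg)).2 fun m hm => hgd ▸ hmin m hm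
    have hdk : d ∈ k • dirichlet G :=
      (mem_smul_dirichlet (hS₂ hk)).2 fun m hm => by rw [← hkd, ← hd]; exact hmin m hm
    have hgk : g ≠ k := by
      rintro rfl
      exact hk.2 hg.2
    have hne (m : SL(2, ℝ)) (hm : m ∈ G) : d ≠ m • I := by
      rintro rfl
      have e1 := (mem_smul_dirichlet (hS₁ hg)).1 hdg m hm
      have e2 := (mem_smul_dirichlet (hS₂ hk)).1 hdk m hm
      rw [dist_self] at e1 e2
      exact hgk (hG.eq_of_smul_I_eq (hS₁ hg) (hS₂ hk)
        ((dist_le_zero.1 e1).symm.trans (dist_le_zero.1 e2)))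
    have hdI : d ≠ I := by simpa using hne 1 G.one_mem
    have hdsI : s⁻¹ • d ≠ I := by
      intro h
      exact hne s hs.1 (by rw [← h, smul_inv_smul])
    by_cases hsub : (g • dirichlet G ∩ k • dirichlet G).Subsingleton
    · refine ⟨d, ⟨g, hS₁ hg, k, hS₂ hk, ⟨hdg, hdk⟩, hsub⟩, ?_⟩
      rcases hdC with h | ⟨w, hw, rfl⟩
      · exact Or.inl ⟨hdI, h⟩
      · exact Or.inr ⟨hdsI, by simpa using hw⟩
    -- If the two tiles shared a side, the cut would leave only the pair `s`, `1`. Then `d` is on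
    -- the bisector, which the broken path meets only at `σ t`, contradicting `σ t ∉ dirichlet G`.
    · exfalso
      rw [Set.not_subsingleton_iff] at hsub
      have hside : g⁻¹ * k ∈ sidePairings G := by
        refine ⟨G.mul_mem (G.inv_mem (hS₁ hg)) (hS₂ hk), fun h => hgk (inv_mul_eq_one.1 h), ?_⟩
        have : dirichlet G ∩ (g⁻¹ * k) • dirichlet G =
            g⁻¹ • (g • dirichlet G ∩ k • dirichlet G) := by
          rw [Set.smul_set_inter, inv_smul_smul, mul_smul]
        rw [this]
        exact hsub.image (MulAction.injective g⁻¹)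
      obtain ⟨rfl, h2⟩ := hcut g (hS₁ hg) _ hside hg.2 (by rw [mul_inv_cancel_left]; exact hk.2)
      have hk1 : k = 1 := by
        rw [inv_mul_eq_iff_eq_mul, mul_inv_cancel] at h2
        exact h2
      have hdF : d ∈ dirichlet G := by rw [hk1, one_smul] at hdk; exact hdk
      have hb : dist d I = dist d (g • I) := by
        refine le_antisymm (hdF _ (hS₁ hg)) ?_
        simpa using (mem_smul_dirichlet (hS₁ hg)).1 hdg 1 G.one_mem
      have hdt : d = σ t := by
        rcases hdC with h | ⟨w, hw, rfl⟩
        · exact eq_of_mem_segI_of_bisector hIs (hσb t) h hb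
        · have := eq_of_mem_segI_of_bisector hIs' (hsinv t) hw
            (by
              have e : dist w (g⁻¹ • I) = dist (g • w) I := by rw [← dist_smul g w, smul_inv_smul]
              rw [e, ← dist_smul g w I]
              exact hb.symm)
          change g • w = σ t
          rw [this, smul_inv_smul]
      exact ht (hdt ▸ hdF)
  have hopen : IsOpen {t | σ t ∉ dirichlet G} := ((isClosed_dirichlet G).preimage hσc).isOpen_compl
  choose! d hdD hd using key
  have hunc : ¬ {t | σ t ∉ dirichlet G}.Countable := by
    obtain ⟨a, b, hab, hsub⟩ := (mem_nhds_iff_exists_Ioo_subset).1 (hopen.mem_nhds hzF)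
    intro hc
    exact absurd (Cardinal.Real.Ioo_countable_iff.1 (hc.mono hsub)) (not_le.2 (hab.1.trans hab.2))
  apply hunc
  -- Segments from one centre to different points of the bisector meet only at that centre, so `d t`
  -- determines `t` once the half of the path containing it is known.
  have hsplit : {t | σ t ∉ dirichlet G} ⊆
      {t | σ t ∉ dirichlet G ∧ d t ≠ I ∧ d t ∈ segI (σ t)} ∪
      {t | σ t ∉ dirichlet G ∧ s⁻¹ • d t ≠ I ∧ s⁻¹ • d t ∈ segI (s⁻¹ • σ t)} := by
    intro t ht
    rcases hd t ht with h | h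
    · exact Or.inl ⟨ht, h⟩
    · exact Or.inr ⟨ht, h⟩
  refine (Set.Countable.union ?_ ?_).mono hsplit
  · refine Set.MapsTo.countable_of_injOn (f := d) (t := D) (fun t ht => hdD t ht.1) ?_ hD
    intro t ht t' ht' h
    exact hσi (eq_of_mem_segI hIs (hσb t) (hσb t') ht.2.2 (h ▸ ht'.2.2) ht.2.1)
  · refine Set.MapsTo.countable_of_injOn (f := d) (t := D) (fun t ht => hdD t ht.1) ?_ hD
    intro t ht t' ht' h
    have := eq_of_mem_segI hIs' (hsinv t) (hsinv t') ht.2.2 (h ▸ ht'.2.2) ht.2.1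
    exact hσi (MulAction.injective _ this)

/-- A side does not meet the half-plane of any other element of the group. -/
theorem gap_pos_of_bisector {s k : SL(2, ℝ)} (hs : s ∈ sidePairings G) (hk : k ∈ G) (hk1 : k ≠ 1)
    (hks : k ≠ s) {z : ℍ} (hz : dist z I = dist z (s • I)) : 0 < gap I (k • I) z := by
  have hF := hG.mem_dirichlet_of_bisector hs hz
  refine lt_of_le_of_ne (gap_nonneg_iff.2 (hF k hk)) fun h0 => ?_
  have hzk : dist z I = dist z (k • I) := gap_eq_zero_iff.1 h0.symm
  obtain ⟨σ, -, hσi, rfl, hσb, hσl⟩ := exists_bisector_line hz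
  -- Along the bisector line the gap to `k • I` vanishes at `0`, so it is a multiple of `sinh`; it
  -- is nonnegative on both sides because the line lies in the Dirichlet domain, so it vanishes
  -- identically. Two points are then equidistant from three orbit points.
  obtain ⟨a, b, hab⟩ := (hσl (k • I)).sub (hσl I)
  have ha : a = 0 := by
    have := hab 0
    simp only [hzk] at this
    simpa using this.symm
  have hpos (t : ℝ) : 0 ≤ b * Real.sinh t := by
    have h1 := hG.mem_dirichlet_of_bisector hs (hσb t) k hk
    have h2 := hab t
    simp only [ha, zero_mul, zero_add] at h2
    rw [← h2]
    exact gap_nonneg_iff.2 h1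
  have hb : b = 0 := by
    have h1 := hpos 1
    have h2 := hpos (-1)
    have h3 : 0 < Real.sinh 1 := Real.sinh_pos_iff.2 one_pos
    rw [Real.sinh_neg] at h2
    nlinarith
  have hz1 : dist (σ 1) I = dist (σ 1) (k • I) := by
    have := hab 1
    simp only [ha, hb, zero_mul, zero_add] at this
    exact gap_eq_zero_iff.1 this
  have hne : σ 0 ≠ σ 1 := fun h => zero_ne_one (hσi h)
  rcases eq_or_eq_of_equidistant hne hz hzk (hσb 1) hz1 with h | h | h
  · exact hG.smul_I_ne hs h
  · exact hk1 (hG.eq_one_of_smul_I k hk h.symm)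
  · exact hks (hG.eq_of_smul_I_eq hk hs.1 h.symm)

/-- The half-planes belonging to different side pairings are disjoint. -/
theorem gap_pos_of_gap_nonpos {s k : SL(2, ℝ)} (hs : s ∈ sidePairings G) (hk : k ∈ sidePairings G)
    (hks : k ≠ s) {z : ℍ} (hz : gap I (s • I) z ≤ 0) : 0 < gap I (k • I) z := by
  by_contra! hzk
  obtain ⟨φ, -, hφ⟩ := exists_eq_polar z
  have hroot {m : SL(2, ℝ)} (hm : m ∈ sidePairings G) (hzm : gap I (m • I) z ≤ 0) :
      ∃ t ∈ Set.Icc 0 (dist I z), gap I (m • I) (polar t φ) = 0 ∧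
        ∀ t' ∈ Set.Icc t (dist I z), gap I (m • I) (polar t' φ) ≤ 0 := by
    have h0 : 0 < gap I (m • I) (polar 0 φ) := by
      rw [polar_zero]; exact gap_self_pos (hG.smul_I_ne hm)
    have hc := (hypLinear_gap_polar I (m • I) φ).continuous
    obtain ⟨t, ht, ht0⟩ := intermediate_value_Icc' (dist_nonneg : 0 ≤ dist I z) hc.continuousOn
      (show (0 : ℝ) ∈ Set.Icc _ _ from ⟨by simpa only [← hφ] using hzm, h0.le⟩)
    refine ⟨t, ht, ht0, fun t' ht' => ?_⟩
    refine (hypLinear_gap_polar I (m • I) φ).nonpos_of_mem_Icc ht0.le ?_ ht'.1 ht'.2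
    simpa only [← hφ] using hzm
  obtain ⟨t, ht, ht0, htn⟩ := hroot hs hz
  obtain ⟨t', ht', ht0', htn'⟩ := hroot hk hzk
  -- The bisector that is crossed later is crossed inside the half-plane of the other, which
  -- `gap_pos_of_bisector` excludes.
  rcases le_total t t' with h | h
  · have := hG.gap_pos_of_bisector hk hs.1 hs.2.1 hks.symm (gap_eq_zero_iff.1 ht0')
    exact absurd (htn t' ⟨h, ht'.2⟩) (not_le.2 this)
  · have := hG.gap_pos_of_bisector hs hk.1 hk.2.1 hks (gap_eq_zero_iff.1 ht0)
    exact absurd (htn' t ⟨h, ht.2⟩) (not_le.2 this)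

end IsTreeLike

end CuspWinding

/-! ### From free generation to cuts of the Cayley graph -/

namespace CuspWinding

section FreeGroup

open FreeGroup

/-- Right multiplication by a letter appends it or cancels the last letter, so the first letter can
be lost only from a word of length one. -/
lemma startsWith_mul_mk {α : Type*} [DecidableEq α] {w a : α × Bool} {g : FreeGroup α}
    (hg : g ∈ startsWith w) (hga : g * mk [a] ∉ startsWith w) : g = mk [w] ∧ a = (w.1, !w.2) := by
  obtain ⟨l, hl⟩ : ∃ l, g.toWord = w :: l := by
    simp only [startsWith, Set.mem_ofPred_eq] at hg
    cases h : g.toWord with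
    | nil => simp [h] at hg
    | cons b l => exact ⟨l, by simpa [h] using hg⟩
  have hred : IsReduced (w :: l) := hl ▸ isReduced_toWord
  have hmk : g = mk (w :: l) := by rw [← hl, mk_toWord]
  rcases l.eq_nil_or_concat with rfl | ⟨l', b, rfl⟩
  · refine ⟨hmk, ?_⟩
    by_contra hne
    apply hga
    have hred' : IsReduced [w, a] := by
      simp only [isReduced_cons_cons, IsReduced.singleton, and_true]
      intro h
      by_contra h'
      apply hne
      refine Prod.ext h.symm ?_
      cases hw : w.2 <;> cases ha : a.2 <;> simp_all
    rw [hmk, mul_mk]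
    simp [startsWith, toWord_mk, hred'.reduce_eq]
  · exfalso
    apply hga
    by_cases hba : b.1 = a.1 ∧ b.2 = !a.2
    · have : g * mk [a] = mk (w :: l') := by
        rw [hmk, mul_mk]
        have e : b = (a.1, !a.2) := Prod.ext hba.1 hba.2
        rw [e]
        have := Red.Step.not_rev (α := α) (L₁ := w :: l') (L₂ := []) (x := a.1) (b := a.2)
        have h2 : mk (w :: l' ++ (a.1, !a.2) :: (a.1, a.2) :: []) = mk (w :: l' ++ []) :=
          Quot.sound this
        simpa using h2
      have hr' : IsReduced (w :: l') := hred.infix ⟨[], [b], by simp⟩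
      rw [this]
      simp [startsWith, toWord_mk, hr'.reduce_eq]
    · have hr' : IsReduced ((w :: l') ++ [b] ++ [a]) := by
        refine IsReduced.append_overlap (by simpa using hred) ?_ (by simp)
        simp only [List.singleton_append, isReduced_cons_cons, IsReduced.singleton, and_true]
        intro h
        by_contra h'
        apply hba
        refine ⟨h, ?_⟩
        cases hb : b.2 <;> cases ha : a.2 <;> simp_all
      rw [hmk, mul_mk]
      have e : (mk (w :: (l'.concat b) ++ [a])).toWord = (w :: l') ++ [b] ++ [a] := by
        rw [show w :: (l'.concat b) ++ [a] = (w :: l') ++ [b] ++ [a] by simp, toWord_mk,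
          hr'.reduce_eq]
      simp only [startsWith, Set.mem_ofPred_eq, e]
      simp

end FreeGroup

lemma mem_symmGenerators_iff {u v : ℕ} (h : Fin u → SL(2, ℝ)) (γ : Fin v → SL(2, ℝ))
    (g : SL(2, ℝ)) : g ∈ symmGenerators h γ ↔
      ∃ a, g = FreeGroup.lift (Sum.elim h γ) (FreeGroup.mk [a]) := by
  constructor
  · rintro (⟨i, rfl | rfl⟩ | ⟨i, rfl | rfl⟩)
    · exact ⟨(Sum.inl i, true), by simp⟩
    · exact ⟨(Sum.inl i, false), by simp⟩
    · exact ⟨(Sum.inr i, true), by simp⟩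
    · exact ⟨(Sum.inr i, false), by simp⟩
  · rintro ⟨⟨i | i, b⟩, rfl⟩
    · exact Or.inl ⟨i, by cases b <;> simp⟩
    · exact Or.inr ⟨i, by cases b <;> simp⟩

/-- The cut of a letter consists of the elements whose reduced word starts with it. Proper
discontinuity makes the stabiliser of `I` finite, and a free group has no torsion. -/
theorem isTreeLike_of_free {G : Subgroup SL(2, ℝ)} (hdisc : DiscreteTopology G) {u v : ℕ}
    {h : Fin u → SL(2, ℝ)} {γ : Fin v → SL(2, ℝ)}
    (hfree : Function.Injective (FreeGroup.lift (Sum.elim h γ)))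
    (hgen : (FreeGroup.lift (Sum.elim h γ)).range = G)
    (hside : sidePairings G = symmGenerators h γ) : IsTreeLike G where
  finite_sidePairings := by
    have : symmGenerators h γ ⊆ Set.range fun a => FreeGroup.lift (Sum.elim h γ) (FreeGroup.mk [a]) :=
      fun g hg => by
        obtain ⟨a, rfl⟩ := (mem_symmGenerators_iff h γ g).1 hg
        exact ⟨a, rfl⟩
    exact hside ▸ (Set.finite_range _).subset this
  finite_ball R := by
    have hfin := ProperlyDiscontinuousSMul.finite_disjoint_inter_image (Γ := G) (T := ℍ)
      (isCompact_singleton (x := I)) (isCompact_closedBall I R)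
    refine (hfin.image Subtype.val).subset ?_
    rintro g ⟨hg, hd⟩
    refine ⟨⟨g, hg⟩, ⟨g • I, ⟨I, rfl, rfl⟩, ?_⟩, rfl⟩
    rwa [Metric.mem_closedBall, dist_comm]
  eq_one_of_smul_I g hg hgI := by
    rw [← hgen] at hg
    obtain ⟨w, rfl⟩ := hg
    set f := FreeGroup.lift (Sum.elim h γ)
    have hfin : {k : G | k • I = I}.Finite :=
      ProperlyDiscontinuousSMul.finite_stabilizer' G I
    have hw : f w ∈ G := hgen ▸ ⟨w, rfl⟩
    have hpow : IsOfFinOrder (⟨f w, hw⟩ : G) := by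
      by_contra hinf
      refine Set.infinite_of_injective_forall_mem (injective_pow_iff_not_isOfFinOrder.2 hinf)
        (fun n => ?_) hfin
      change (f w ^ n : SL(2, ℝ)) • I = I
      induction n with
      | zero => simp
      | succ n ih => rw [pow_succ, mul_smul, hgI, ih]
    have h1 : IsOfFinOrder (f w) := Submonoid.isOfFinOrder_coe.2 hpow
    have h2 : IsOfFinOrder w := (hfree.isOfFinOrder_iff).1 h1
    rw [(isOfFinOrder_iff_eq_one w).1 h2, map_one]
  inv_mem s hs := by
    rw [hside] at hs ⊢
    rcases hs with ⟨i, rfl | rfl⟩ | ⟨i, rfl | rfl⟩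
    · exact Or.inl ⟨i, Or.inr rfl⟩
    · exact Or.inl ⟨i, Or.inl (inv_inv _)⟩
    · exact Or.inr ⟨i, Or.inr rfl⟩
    · exact Or.inr ⟨i, Or.inl (inv_inv _)⟩
  exists_cut s hs := by
    rw [hside, mem_symmGenerators_iff] at hs
    obtain ⟨w, rfl⟩ := hs
    set f := FreeGroup.lift (Sum.elim h γ)
    refine ⟨f '' FreeGroup.startsWith w, ⟨_, by simp [FreeGroup.startsWith], rfl⟩, ?_, ?_⟩
    · rintro ⟨x, hx, hx1⟩
      exact FreeGroup.startsWith.ne_one x hx (hfree (by rw [hx1, map_one]))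
    · rintro g - t ht ⟨x, hx, rfl⟩ hgt
      rw [hside, mem_symmGenerators_iff] at ht
      obtain ⟨a, rfl⟩ := ht
      have : x * FreeGroup.mk [a] ∉ FreeGroup.startsWith w := by
        intro hmem
        exact hgt ⟨_, hmem, map_mul _ _ _⟩
      obtain ⟨rfl, rfl⟩ := startsWith_mul_mk hx this
      exact ⟨rfl, by rw [← map_inv, FreeGroup.inv_mk]; rfl⟩

/-! ### Words -/

lemma prefixProd_zero (ω : ℕ → SL(2, ℝ)) : prefixProd ω 0 = 1 := by
  simp [prefixProd]

lemma prefixProd_succ (ω : ℕ → SL(2, ℝ)) (n : ℕ) :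
    prefixProd ω (n + 1) = prefixProd ω n * ω n := by
  simp [prefixProd, List.range_succ]

/-- A word in the side pairings that is freely reduced. -/
structure IsReducedWord (G : Subgroup SL(2, ℝ)) (ω : ℕ → SL(2, ℝ)) : Prop where
  mem : ∀ n, ω n ∈ sidePairings G
  ne_inv : ∀ n, ω (n + 1) ≠ (ω n)⁻¹

/-- Along a word `ω`, the function whose sublevel set is the half-plane beyond the side between the
tiles number `n` and `n + 1`. -/
noncomputable def wordGap (ω : ℕ → SL(2, ℝ)) (n : ℕ) (z : ℍ) : ℝ :=
  gap (prefixProd ω n • I) (prefixProd ω (n + 1) • I) z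

lemma wordGap_eq (ω : ℕ → SL(2, ℝ)) (n : ℕ) (z : ℍ) :
    wordGap ω n z = gap I (ω n • I) ((prefixProd ω n)⁻¹ • z) := by
  rw [wordGap, prefixProd_succ, mul_smul, gap_smul']

lemma wordGap_eq' (ω : ℕ → SL(2, ℝ)) (n : ℕ) (z : ℍ) :
    wordGap ω n z = -gap I ((ω n)⁻¹ • I) ((prefixProd ω (n + 1))⁻¹ • z) := by
  rw [← gap_swap, wordGap, ← gap_smul', ← mul_smul, prefixProd_succ, mul_inv_cancel_right]

variable {G : Subgroup SL(2, ℝ)} {ω : ℕ → SL(2, ℝ)}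

lemma prefixProd_mem (hω : ∀ n, ω n ∈ sidePairings G) (n : ℕ) : prefixProd ω n ∈ G := by
  induction n with
  | zero => rw [prefixProd_zero]; exact G.one_mem
  | succ n ih => rw [prefixProd_succ]; exact G.mul_mem ih (hω n).1

lemma continuous_wordGap (ω : ℕ → SL(2, ℝ)) (n : ℕ) : Continuous (wordGap ω n) :=
  continuous_gap _ _

lemma hypLinear_wordGap_polar (ω : ℕ → SL(2, ℝ)) (n : ℕ) (φ : ℝ) :
    HypLinear fun t => wordGap ω n (polar t φ) :=
  hypLinear_gap_polar _ _ φ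

/-! ### Nested half-planes along a reduced word -/

namespace IsTreeLike

variable (hG : IsTreeLike G)
include hG

lemma mem_smul_dirichlet_of_wordGap_eq_zero (hω : ∀ n, ω n ∈ sidePairings G) {n : ℕ} {z : ℍ}
    (hz : wordGap ω n z = 0) :
    z ∈ prefixProd ω n • dirichlet G ∧ z ∈ prefixProd ω (n + 1) • dirichlet G := by
  have h1 : z ∈ prefixProd ω n • dirichlet G := by
    rw [Set.mem_smul_set_iff_inv_smul_mem]
    rw [wordGap_eq, gap_eq_zero_iff] at hz
    exact hG.mem_dirichlet_of_bisector (hω n) hz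
  refine ⟨h1, ?_⟩
  rw [mem_smul_dirichlet (prefixProd_mem hω _)] at h1 ⊢
  rw [wordGap, gap_eq_zero_iff] at hz
  rw [← hz]
  exact h1

/-- The half-planes along a reduced word are strictly nested. -/
lemma wordGap_neg_of_succ (hω : IsReducedWord G ω) {n : ℕ} {z : ℍ} (hz : wordGap ω (n + 1) z ≤ 0) :
    wordGap ω n z < 0 := by
  -- Seen from tile `n + 1`, the side behind is labelled `(ω n)⁻¹` and the side ahead `ω (n + 1)`.
  -- The word being reduced, these differ, so their half-planes are disjoint.
  rw [wordGap_eq', neg_lt_zero]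
  rw [wordGap_eq] at hz
  exact hG.gap_pos_of_gap_nonpos (hω.mem _) (hG.inv_mem _ (hω.mem n)) (hω.ne_inv n).symm hz

lemma wordGap_neg_of_lt (hω : IsReducedWord G ω) {m n : ℕ} (hmn : m < n) {z : ℍ}
    (hz : wordGap ω n z ≤ 0) : wordGap ω m z < 0 := by
  induction n, hmn using Nat.le_induction with
  | base => exact hG.wordGap_neg_of_succ hω hz
  | succ n hn ih => exact ih (hG.wordGap_neg_of_succ hω hz).le

lemma wordGap_nonpos_of_le (hω : IsReducedWord G ω) {m n : ℕ} (hmn : m ≤ n) {z : ℍ}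
    (hz : wordGap ω n z ≤ 0) : wordGap ω m z ≤ 0 := by
  rcases hmn.eq_or_lt with rfl | h
  · exact hz
  · exact (hG.wordGap_neg_of_lt hω h hz).le

lemma wordGap_I_pos (hω : IsReducedWord G ω) (n : ℕ) : 0 < wordGap ω n I := by
  have h0 : 0 < wordGap ω 0 I := by
    rw [wordGap_eq, prefixProd_zero, inv_one, one_smul]
    exact gap_self_pos (hG.smul_I_ne (hω.mem 0))
  by_contra! h
  exact absurd (hG.wordGap_nonpos_of_le hω (Nat.zero_le n) h) (not_le.2 h0)

lemma wordGap_prefixProd_nonpos (hω : IsReducedWord G ω) {m n : ℕ} (hmn : m < n) :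
    wordGap ω m (prefixProd ω n • I) ≤ 0 := by
  obtain ⟨k, rfl⟩ : ∃ k, n = k + 1 := ⟨n - 1, by omega⟩
  refine hG.wordGap_nonpos_of_le hω (Nat.lt_succ_iff.1 hmn) ?_
  rw [wordGap, gap_nonpos_iff, dist_self]
  exact dist_nonneg

lemma strictMono_dist_prefixProd (hω : IsReducedWord G ω) :
    StrictMono fun n => dist I (prefixProd ω n • I) :=
  strictMono_nat_of_lt_succ fun n => gap_pos_iff.1 (hG.wordGap_I_pos hω n)

/-- Strict monotonicity makes the orbit points distinct, and a ball contains only finitely many. -/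
lemma tendsto_dist_prefixProd (hω : IsReducedWord G ω) :
    Tendsto (fun n => dist I (prefixProd ω n • I)) atTop atTop := by
  refine tendsto_atTop_atTop_of_monotone (hG.strictMono_dist_prefixProd hω).monotone fun R => ?_
  by_contra! hR
  refine Set.infinite_of_injective_forall_mem (f := prefixProd ω) ?_ (fun n => ?_)
    (hG.finite_ball R)
  · intro m n hmn
    exact (hG.strictMono_dist_prefixProd hω).injective (by simp only [hmn])
  · exact ⟨prefixProd_mem hω.mem n, (hR n).le⟩

/-- Past the last point of a geodesic in a tile, if this point lies on a side, the geodesic is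
beyond that side. -/
lemma gap_neg_of_isGreatest {s : SL(2, ℝ)} (hs : s ∈ sidePairings G) {σ : ℝ → ℍ}
    (hσ : ∀ w, HypLinear fun t => Real.cosh (dist (σ t) w)) (hσc : Continuous σ) {t : ℝ}
    (ht : σ t ∈ dirichlet G) (hts : σ t ∈ s • dirichlet G)
    (hlast : ∀ t' > t, σ t' ∉ dirichlet G) {t' : ℝ} (ht' : t < t') : gap I (s • I) (σ t') < 0 := by
  have hb : dist (σ t) I = dist (σ t) (s • I) := by
    refine le_antisymm (ht s hs.1) ?_
    simpa using (mem_smul_dirichlet hs.1).1 hts 1 G.one_mem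
  have hev : ∀ᶠ x in 𝓝 t, dist (σ x) (σ t) < 1 :=
    hσc.continuousAt.eventually (Metric.ball_mem_nhds _ one_pos)
  -- An orbit point closer than `I` to some `σ x` within distance `1` of `σ t` is in this finite
  -- list. Members other than `1` and `s` stay farther than `I` near `t`, so the tile can only be
  -- left across `s`.
  have hfin := hG.finite_dist_le (σ t) (dist (σ t) I + 2)
  have hpos : ∀ k ∈ {g | g ∈ G ∧ dist (σ t) (g • I) ≤ dist (σ t) I + 2},
      ∀ᶠ x in 𝓝 t, k = 1 ∨ k = s ∨ 0 < gap I (k • I) (σ x) := by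
    rintro k ⟨hk, -⟩
    by_cases hk1 : k = 1
    · exact Eventually.of_forall fun _ => Or.inl hk1
    by_cases hks : k = s
    · exact Eventually.of_forall fun _ => Or.inr (Or.inl hks)
    have h0 := hG.gap_pos_of_bisector hs hk hk1 hks hb
    filter_upwards [((continuous_gap I (k • I)).comp hσc).continuousAt.eventually
      (lt_mem_nhds h0)] with x hx
    exact Or.inr (Or.inr hx)
  have hall := (Filter.eventually_all_finite hfin).2 hpos
  have hgt : ∃ᶠ x in 𝓝 t, t < x := by
    have : (𝓝[>] t).NeBot := inferInstance
    exact (frequently_mem_iff_neBot (l := 𝓝 t) (s := Set.Ioi t)).2 this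
  obtain ⟨x, hx, ⟨hx1, hx2⟩⟩ := (hgt.and_eventually (hev.and hall)).exists
  have hxF := hlast x hx
  simp only [dirichlet, Set.mem_ofPred_eq, not_forall, not_le] at hxF
  obtain ⟨k, hk, hxk⟩ := hxF
  have hkfin : dist (σ t) (k • I) ≤ dist (σ t) I + 2 := by
    have h1 := dist_triangle (σ t) (σ x) (k • I)
    have h2 := dist_triangle (σ x) (σ t) I
    rw [dist_comm] at hx1
    rw [dist_comm (σ x) (σ t)] at h2
    linarith
  have hneg : gap I (k • I) (σ x) < 0 := gap_neg_iff.2 hxk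
  rcases hx2 k ⟨hk, hkfin⟩ with rfl | rfl | h
  · simp at hxk
  · exact ((hσ (k • I)).sub (hσ I)).neg_of_zero_of_neg (gap_eq_zero_iff.2 hb) hx hneg ht'
  · exact absurd h (not_lt.2 hneg.le)

end IsTreeLike

/-- Isometric rays from `I` are radial in polar coordinates. -/
lemma exists_polar_of_isometry {r : ℝ≥0 → ℍ} (hr : Isometry r) (h0 : r 0 = I) :
    ∃ φ, ∀ t, r t = polar t φ := by
  have hd (t : ℝ≥0) : dist I (r t) = t := by
    rw [← h0, hr.dist_eq, NNReal.dist_eq, NNReal.coe_zero, zero_sub, abs_neg, NNReal.abs_eq]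
  obtain ⟨φ, -, hφ⟩ := exists_eq_polar (r 1)
  rw [hd, NNReal.coe_one] at hφ
  refine ⟨φ, fun t => ?_⟩
  obtain ⟨ψ, -, hψ⟩ := exists_eq_polar (r t)
  rw [hd] at hψ
  rcases eq_or_ne t 0 with rfl | ht
  · rw [h0, NNReal.coe_zero, polar_zero]
  have ht' : 0 < Real.sinh t := Real.sinh_pos_iff.2 (NNReal.coe_pos.2 (pos_iff_ne_zero.2 ht))
  have h1 : 0 < Real.sinh 1 := Real.sinh_pos_iff.2 one_pos
  have key : Real.cosh (dist (r t) (r 1)) = Real.cosh (t - 1) := by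
    rw [hr.dist_eq, NNReal.dist_eq, Real.cosh_abs, NNReal.coe_one]
  rw [hφ, hψ, cosh_dist_polar, dist_I_polar, hypX_polar, hypY_polar, Real.cosh_abs,
    Real.cosh_sub] at key
  have hc : Real.cos ψ * Real.cos φ + Real.sin ψ * Real.sin φ = 1 := by
    have : Real.sinh t * Real.sinh 1 *
        (Real.cos ψ * Real.cos φ + Real.sin ψ * Real.sin φ - 1) = 0 := by linear_combination -key
    rcases mul_eq_zero.1 this with h | h
    · exact absurd h (mul_pos ht' h1).ne'
    · linarith
  have e1 := Real.cos_sq_add_sin_sq φ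
  have e2 := Real.cos_sq_add_sin_sq ψ
  have hsq : (Real.cos ψ - Real.cos φ) ^ 2 + (Real.sin ψ - Real.sin φ) ^ 2 = 0 := by
    linear_combination e1 + e2 - 2 * hc
  have c1 : Real.cos ψ = Real.cos φ := by nlinarith [sq_nonneg (Real.sin ψ - Real.sin φ)]
  have c2 : Real.sin ψ = Real.sin φ := by nlinarith [sq_nonneg (Real.cos ψ - Real.cos φ)]
  rw [hψ]
  exact UpperHalfPlane.ext_re_im (by rw [polar_re, polar_re, c1, c2])
    (by rw [polar_im, polar_im, c1])

/-- The word of a boundary point is reduced. -/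
theorem IsExpansion.isReducedWord (hG : IsTreeLike G) {x : OnePoint ℝ} (h : IsExpansion G x ω) :
    IsReducedWord G ω := by
  obtain ⟨r, ⟨hr, hr0, -⟩, hω⟩ := h
  obtain ⟨φ, hφ⟩ := exists_polar_of_isometry hr hr0
  have hmem (n : ℕ) := (hω n).1
  have hneg (n : ℕ) : ∃ t : ℝ, ∀ t' > t, wordGap ω n (polar t' φ) < 0 := by
    obtain ⟨-, t, ⟨ht, hmax⟩, hts⟩ := hω n
    refine ⟨t, fun t' ht' => ?_⟩
    rw [wordGap_eq]
    simp only [Set.mem_ofPred_eq, Set.mem_smul_set_iff_inv_smul_mem, hφ] at ht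
    rw [prefixProd_succ, mul_smul, Set.mem_smul_set_iff_inv_smul_mem, hφ] at hts
    refine hG.gap_neg_of_isGreatest (hmem n) (σ := fun x => (prefixProd ω n)⁻¹ • polar x φ)
      (fun w => ?_) ((continuous_polar_left φ).const_smul _) ht hts (fun y hy => ?_) ht'
    · have e (t : ℝ) : dist ((prefixProd ω n)⁻¹ • polar t φ) w =
          dist (polar t φ) (prefixProd ω n • w) := by
        rw [← dist_smul (prefixProd ω n), smul_inv_smul]
      simp only [e]
      exact hypLinear_cosh_dist_polar φ _
    · intro hyF
      have hy0 : 0 ≤ y := t.2.trans hy.le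
      have := hmax (show (⟨y, hy0⟩ : ℝ≥0) ∈ _ by
        simp only [Set.mem_smul_set_iff_inv_smul_mem, hφ]
        exact hyF)
      exact absurd (NNReal.coe_le_coe.2 this) (not_le.2 hy)
  refine ⟨hmem, fun n hinv => ?_⟩
  -- With `ω (n + 1) = (ω n)⁻¹` the two half-planes would be opposite sides of one bisector, and the
  -- ray would end up inside both.
  obtain ⟨t₁, h₁⟩ := hneg n
  obtain ⟨t₂, h₂⟩ := hneg (n + 1)
  have e1 := h₁ (max t₁ t₂ + 1) (by linarith [le_max_left t₁ t₂])
  have e2 := h₂ (max t₁ t₂ + 1) (by linarith [le_max_right t₁ t₂])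
  rw [wordGap_eq'] at e1
  rw [wordGap_eq, hinv] at e2
  linarith

end CuspWinding

namespace CuspWinding

/-! ### Charts at the cusps -/

/-- Upper half-plane coordinates in which `g` is the translation by `1` and `I` lies on the
imaginary axis. -/
structure IsCuspChart (g : SL(2, ℝ)) (Ψ : ℍ → ℍ) : Prop where
  isometry : Isometry Ψ
  surjective : Function.Surjective Ψ
  re_I : (Ψ I).re = 0
  re_smul : ∀ z, (Ψ (g • z)).re = (Ψ z).re + 1
  im_smul : ∀ z, (Ψ (g • z)).im = (Ψ z).im

/-- The isometry `x + iy ↦ (x / c - b) + i (y / |c|)`. -/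
noncomputable def affineMap (c b : ℝ) (hc : c ≠ 0) (z : ℍ) : ℍ :=
  ⟨⟨z.re / c - b, z.im / |c|⟩, div_pos z.im_pos (abs_pos.2 hc)⟩

lemma affineMap_re (c b : ℝ) (hc : c ≠ 0) (z : ℍ) : (affineMap c b hc z).re = z.re / c - b := rfl

lemma affineMap_im (c b : ℝ) (hc : c ≠ 0) (z : ℍ) : (affineMap c b hc z).im = z.im / |c| := rfl

lemma isometry_affineMap (c b : ℝ) (hc : c ≠ 0) : Isometry (affineMap c b hc) := by
  refine Isometry.of_dist_eq fun z w => ?_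
  refine Real.cosh_strictMonoOn.injOn (Set.mem_Ici.2 dist_nonneg) (Set.mem_Ici.2 dist_nonneg) ?_
  rw [cosh_dist_eq, cosh_dist_eq]
  simp only [affineMap_re, affineMap_im]
  have hz := z.im_pos
  have hw := w.im_pos
  have hc' := abs_pos.2 hc
  have e : ((z.re / c - b - (w.re / c - b)) ^ 2 + (z.im / |c| - w.im / |c|) ^ 2) =
      ((z.re - w.re) ^ 2 + (z.im - w.im) ^ 2) / |c| ^ 2 := by
    have e1 : (z.re / c - b - (w.re / c - b)) ^ 2 = (z.re - w.re) ^ 2 / |c| ^ 2 := by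
      rw [sq_abs]; field_simp; ring
    rw [e1]; field_simp
  rw [e]
  field_simp

lemma surjective_affineMap (c b : ℝ) (hc : c ≠ 0) : Function.Surjective (affineMap c b hc) := by
  intro z
  refine ⟨⟨⟨(z.re + b) * c, z.im * |c|⟩, mul_pos z.im_pos (abs_pos.2 hc)⟩, ?_⟩
  have hc' := (abs_pos.2 hc).ne'
  refine UpperHalfPlane.ext_re_im ?_ ?_
  · change (z.re + b) * c / c - b = z.re
    field_simp; ring
  · change z.im * |c| / |c| = z.im
    field_simp

lemma exists_smul_eq_add_of_upper {g : SL(2, ℝ)} (hg : g.1.IsParabolic) (h10 : g 1 0 = 0) :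
    ∃ c ≠ (0 : ℝ), ∀ z : ℍ, (g • z).re = z.re + c ∧ (g • z).im = z.im := by
  obtain ⟨h1, h2⟩ := (Matrix.isParabolic_iff_of_upperTriangular h10).1 hg
  have hdet := g.det_coe
  rw [Matrix.det_fin_two] at hdet
  change g 0 0 = g 1 1 at h1
  change g 0 1 ≠ 0 at h2
  change g 0 0 * g 1 1 - g 0 1 * g 1 0 = 1 at hdet
  rw [h10, ← h1] at hdet
  have h0 : g 0 0 ≠ 0 := by
    intro h; rw [h] at hdet; simp at hdet
  have key (z : ℍ) : ((g • z : ℍ) : ℂ) = z + ((g 0 1 / g 0 0 : ℝ) : ℂ) := by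
    rw [coe_specialLinearGroup_apply, h10, ← h1]
    have : ((g 0 0 : ℝ) : ℂ) ≠ 0 := by exact_mod_cast h0
    simp only [Algebra.algebraMap_self, RingHom.id_apply]
    rw [Complex.ofReal_zero, zero_mul, zero_add, add_div, mul_div_cancel_left₀ _ this,
      Complex.ofReal_div]
  refine ⟨g 0 1 / g 0 0, div_ne_zero h2 h0, fun z => ⟨?_, ?_⟩⟩
  · rw [← coe_re, key, Complex.add_re, Complex.ofReal_re, coe_re]
  · rw [← coe_im, key, Complex.add_im, Complex.ofReal_im, coe_im, add_zero]

/-- Unless `g` already fixes infinity, its only fixed point is the double root `x`, and `A` is `z ↦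
-1 / (z - x)`, sending `x` to infinity. -/
lemma exists_conj_upper {g : SL(2, ℝ)} (hg : g.1.IsParabolic) :
    ∃ A : SL(2, ℝ), (A * g * A⁻¹) 1 0 = 0 := by
  rcases eq_or_ne (g 1 0) 0 with h | h
  · exact ⟨1, by simpa using h⟩
  set x := (g 0 0 - g 1 1) / (2 * g 1 0)
  have hd := hg.2
  rw [Matrix.discr_fin_two, Matrix.trace_fin_two, Matrix.det_fin_two] at hd
  have hx : x * (2 * g 1 0) = g 0 0 - g 1 1 := div_mul_cancel₀ _ (by simpa using h)
  change (g 0 0 + g 1 1) ^ 2 - 4 * (g 0 0 * g 1 1 - g 0 1 * g 1 0) = 0 at hd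
  have h4 : 4 * g 1 0 * (-x * g 0 0 + x ^ 2 * g 1 0 - g 0 1 + x * g 1 1) = 0 := by
    linear_combination (x * (2 * g 1 0) - g 0 0 + g 1 1) * hx - hd
  have h5 : -x * g 0 0 + x ^ 2 * g 1 0 - g 0 1 + x * g 1 1 = 0 := by
    rcases mul_eq_zero.1 h4 with h' | h'
    · exact absurd h' (mul_ne_zero four_ne_zero h)
    · exact h'
  refine ⟨⟨!![0, -1; 1, -x], by simp [Matrix.det_fin_two]⟩, ?_⟩
  change (!![0, -1; 1, -x] * g.1 * (!![0, -1; 1, -x] : Matrix (Fin 2) (Fin 2) ℝ).adjugate) 1 0 = 0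
  rw [Matrix.adjugate_fin_two]
  simp [Matrix.mul_apply, Fin.sum_univ_two, Matrix.vecMul, dotProduct]
  clear_value x
  linear_combination h5

lemma isParabolic_conj {g A : SL(2, ℝ)} (hg : g.1.IsParabolic) :
    (A * g * A⁻¹).1.IsParabolic := by
  have := (Matrix.isParabolic_conj_iff (A : GL (Fin 2) ℝ) (m := g.1)).2 hg
  simpa [Matrix.inv_def] using this

/-- After the fixed point is moved to infinity, dividing by the translation length `c` normalises it
to `1`. For `c < 0` this reverses orientation, so a chart is merely an isometry. -/
lemma exists_isCuspChart {g : SL(2, ℝ)} (hg : g.1.IsParabolic) : ∃ Ψ, IsCuspChart g Ψ := by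
  obtain ⟨A, hA⟩ := exists_conj_upper hg
  obtain ⟨c, hc, h⟩ := exists_smul_eq_add_of_upper (isParabolic_conj hg) hA
  have h' (z : ℍ) : (A • g • z).re = (A • z).re + c ∧ (A • g • z).im = (A • z).im := by
    have := h (A • z)
    rwa [← mul_smul, inv_mul_cancel_right, mul_smul] at this
  refine ⟨fun z => affineMap c ((A • I).re / c) hc (A • z),
    (isometry_affineMap _ _ hc).comp (isometry_smul ℍ A),
    (surjective_affineMap _ _ hc).comp (MulAction.surjective A), ?_, fun z => ?_, fun z => ?_⟩
  · rw [affineMap_re, sub_self]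
  · rw [affineMap_re, affineMap_re, (h' z).1]
    field_simp
    ring
  · rw [affineMap_im, affineMap_im, (h' z).2]

/-- A half-plane inside a vertical strip of width `1` has height at most `1 / 2`. -/
lemma im_le_half_of_strip {p q : ℍ} (h : ∀ z, gap p q z ≤ 0 → |z.re| < 1 / 2) {z : ℍ}
    (hz : gap p q z ≤ 0) : z.im ≤ 1 / 2 := by
  set a := 1 / q.im - 1 / p.im
  set b := -2 * q.re / q.im + 2 * p.re / p.im
  set d := (q.re ^ 2 + q.im ^ 2) / q.im - (p.re ^ 2 + p.im ^ 2) / p.im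
  have key (w : ℍ) : 2 * w.im * gap p q w = a * (w.re ^ 2 + w.im ^ 2) + b * w.re + d := by
    have hw := w.im_pos
    have hp := p.im_pos
    have hq := q.im_pos
    rw [gap, cosh_dist_eq, cosh_dist_eq]
    simp only [a, b, d]
    field_simp
    ring
  have key' (x y : ℝ) (hy : 0 < y) (hxy : a * (x ^ 2 + y ^ 2) + b * x + d ≤ 0) : |x| < 1 / 2 := by
    refine h ⟨⟨x, y⟩, hy⟩ ?_
    have := key ⟨⟨x, y⟩, hy⟩
    have hle : 2 * y * gap p q ⟨⟨x, y⟩, hy⟩ ≤ 0 := by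
      rw [show (⟨⟨x, y⟩, hy⟩ : ℍ).im = y from rfl, show (⟨⟨x, y⟩, hy⟩ : ℍ).re = x from rfl] at this
      rwa [this]
    exact nonpos_of_mul_nonpos_right hle (by positivity)
  -- For `a ≤ 0` the point `z` can be shifted horizontally by `1` within the half-plane, out of the
  -- strip. For `a > 0` the half-plane is a half-disc centred at `c`; if it reached above `1 / 2` it
  -- would contain points over both `c - 1 / 2` and `c + 1 / 2`, too far apart for the open strip.
  by_contra! hlt
  have hz0 : a * (z.re ^ 2 + z.im ^ 2) + b * z.re + d ≤ 0 := by
    rw [← key]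
    exact mul_nonpos_of_nonneg_of_nonpos (by linarith) hz
  have hx0 := abs_lt.1 (key' _ _ z.im_pos hz0)
  rcases le_or_gt a 0 with ha | ha
  · rcases le_total (2 * a * z.re + b) 0 with hs | hs
    · have := abs_lt.1 (key' (z.re + 1) z.im z.im_pos (by nlinarith))
      linarith [this.2]
    · have := abs_lt.1 (key' (z.re - 1) z.im z.im_pos (by nlinarith))
      linarith [this.1]
  · have hy : 0 < z.im ^ 2 - 1 / 4 := by nlinarith
    set y := √(z.im ^ 2 - 1 / 4)
    have hy0 : 0 < y := Real.sqrt_pos.2 hy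
    have hy2 : y ^ 2 = z.im ^ 2 - 1 / 4 := Real.sq_sqrt hy.le
    set c := -b / (2 * a)
    have hb : b = -2 * a * c := by simp only [c]; field_simp
    have hsq : 0 ≤ a * (z.re - c) ^ 2 := by positivity
    have h1 := abs_lt.1 (key' (c + 1 / 2) y hy0 (by rw [hy2]; rw [hb] at hz0 ⊢; nlinarith))
    have h2 := abs_lt.1 (key' (c - 1 / 2) y hy0 (by rw [hy2]; rw [hb] at hz0 ⊢; nlinarith))
    linarith [h1.2, h2.1]

lemma Isometry.gap_eq {Ψ : ℍ → ℍ} (h : Isometry Ψ) (p q z : ℍ) :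
    gap (Ψ p) (Ψ q) (Ψ z) = gap p q z := by
  rw [gap, gap, h.dist_eq, h.dist_eq]

namespace IsCuspChart

variable {g : SL(2, ℝ)} {Ψ : ℍ → ℍ} (h : IsCuspChart g Ψ)
include h

lemma re_pow_smul (n : ℕ) (z : ℍ) : (Ψ (g ^ n • z)).re = (Ψ z).re + n := by
  induction n with
  | zero => simp
  | succ n ih => rw [pow_succ', mul_smul, h.re_smul, ih]; push_cast; ring

lemma im_pow_smul (n : ℕ) (z : ℍ) : (Ψ (g ^ n • z)).im = (Ψ z).im := by
  induction n with
  | zero => simp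
  | succ n ih => rw [pow_succ', mul_smul, h.im_smul, ih]

lemma gap_eq (z : ℍ) :
    gap I (g • I) z = (1 - 2 * (Ψ z).re) / (2 * (Ψ z).im * (Ψ I).im) := by
  have h1 := (Ψ z).im_pos
  have h2 := (Ψ I).im_pos
  rw [← Isometry.gap_eq h.isometry, gap, cosh_dist_eq, cosh_dist_eq, h.re_smul, h.im_smul, h.re_I]
  field_simp
  ring

lemma gap_inv_eq (z : ℍ) :
    gap I (g⁻¹ • I) z = (1 + 2 * (Ψ z).re) / (2 * (Ψ z).im * (Ψ I).im) := by
  have h1 := (Ψ z).im_pos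
  have h2 := (Ψ I).im_pos
  have e1 := h.re_smul (g⁻¹ • I)
  have e2 := h.im_smul (g⁻¹ • I)
  rw [smul_inv_smul] at e1 e2
  rw [h.re_I] at e1
  have e3 : (Ψ (g⁻¹ • I)).re = -1 := by linarith
  rw [← Isometry.gap_eq h.isometry, gap, cosh_dist_eq, cosh_dist_eq, ← e2, e3, h.re_I]
  field_simp
  ring

lemma gap_nonpos_iff (z : ℍ) : gap I (g • I) z ≤ 0 ↔ 1 / 2 ≤ (Ψ z).re := by
  have h1 := (Ψ z).im_pos
  have h2 := (Ψ I).im_pos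
  rw [h.gap_eq, div_le_iff₀ (by positivity), zero_mul]
  constructor <;> intro h <;> linarith

lemma gap_nonneg_iff (z : ℍ) : 0 ≤ gap I (g • I) z ↔ (Ψ z).re ≤ 1 / 2 := by
  have h1 := (Ψ z).im_pos
  have h2 := (Ψ I).im_pos
  rw [h.gap_eq, le_div_iff₀ (by positivity), zero_mul]
  constructor <;> intro h <;> linarith

lemma gap_inv_nonpos_iff (z : ℍ) : gap I (g⁻¹ • I) z ≤ 0 ↔ (Ψ z).re ≤ -(1 / 2) := by
  have h1 := (Ψ z).im_pos
  have h2 := (Ψ I).im_pos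
  rw [h.gap_inv_eq, div_le_iff₀ (by positivity), zero_mul]
  constructor <;> intro h <;> linarith

lemma gap_inv_nonneg_iff (z : ℍ) : 0 ≤ gap I (g⁻¹ • I) z ↔ -(1 / 2) ≤ (Ψ z).re := by
  have h1 := (Ψ z).im_pos
  have h2 := (Ψ I).im_pos
  rw [h.gap_inv_eq, le_div_iff₀ (by positivity), zero_mul]
  constructor <;> intro h <;> linarith

variable {G : Subgroup SL(2, ℝ)}

lemma abs_re_le (hg : g ∈ G) {z : ℍ} (hz : z ∈ dirichlet G) : |(Ψ z).re| ≤ 1 / 2 := by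
  rw [abs_le]
  exact ⟨(h.gap_inv_nonneg_iff z).1 (CuspWinding.gap_nonneg_iff.2 (hz _ (G.inv_mem hg))),
    (h.gap_nonneg_iff z).1 (CuspWinding.gap_nonneg_iff.2 (hz _ hg))⟩

/-- In the chart of a cusp, the half-planes of the other side pairings lie below height `1 / 2`. -/
lemma im_le_half (hG : IsTreeLike G) (hg : g ∈ sidePairings G) {k : SL(2, ℝ)}
    (hk : k ∈ sidePairings G) (hkg : k ≠ g) (hkg' : k ≠ g⁻¹) {z : ℍ}
    (hz : gap I (k • I) z ≤ 0) : |(Ψ z).re| < 1 / 2 ∧ (Ψ z).im ≤ 1 / 2 := by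
  have hre (w : ℍ) (hw : gap I (k • I) w ≤ 0) : |(Ψ w).re| < 1 / 2 := by
    have h1 := hG.gap_pos_of_gap_nonpos hk hg hkg.symm hw
    have h2 := hG.gap_pos_of_gap_nonpos hk (hG.inv_mem g hg) hkg'.symm hw
    rw [← not_le, h.gap_nonpos_iff, not_le] at h1
    rw [← not_le, h.gap_inv_nonpos_iff, not_le] at h2
    exact abs_lt.2 ⟨h2, h1⟩
  refine ⟨hre z hz, im_le_half_of_strip (p := Ψ I) (q := Ψ (k • I)) (fun w hw => ?_) ?_⟩
  · obtain ⟨w, rfl⟩ := h.surjective w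
    rw [Isometry.gap_eq h.isometry] at hw
    exact hre w hw
  · rwa [Isometry.gap_eq h.isometry]

/-- Inside the Dirichlet domain, the horoballs at different cusps are disjoint. -/
lemma im_le_one_or (hG : IsTreeLike G) (hg : g ∈ sidePairings G) {k : SL(2, ℝ)} {Φ : ℍ → ℍ}
    (hΦ : IsCuspChart k Φ) (hk : k ∈ sidePairings G) (hkg : k ≠ g) (hkg' : k ≠ g⁻¹) {z : ℍ}
    (hz : z ∈ dirichlet G) : (Ψ z).im ≤ 1 ∨ (Φ z).im ≤ 1 := by
  by_contra! hlt
  obtain ⟨h1, h2⟩ := hlt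
  have hre := abs_le.1 (hΦ.abs_re_le hk.1 hz)
  -- Shift `z` in the chart `Φ` to the nearer edge of the strip: by at most `1 / 2`, at height above
  -- `1`. There `w` lies on the bisector of `k` or `k⁻¹`, so below `1 / 2` in the chart `Ψ`, where
  -- `z` is above `1`. The bounds `1 + 1 / 8` and `1 + 1 / 4` on `cosh (dist z w)` clash.
  obtain ⟨w, hw, hwre, hwim⟩ : ∃ w, (Ψ w).im ≤ 1 / 2 ∧ ((Φ z).re - (Φ w).re) ^ 2 ≤ 1 / 4 ∧
      (Φ w).im = (Φ z).im := by
    rcases le_total 0 (Φ z).re with h0 | h0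
    · obtain ⟨w, hw⟩ := hΦ.surjective ⟨⟨1 / 2, (Φ z).im⟩, (Φ z).im_pos⟩
      have e1 : (Φ w).re = 1 / 2 := by rw [hw]; rfl
      refine ⟨w, (h.im_le_half hG hg hk hkg hkg' ((hΦ.gap_nonpos_iff w).2 e1.ge)).2, ?_, by rw [hw]; rfl⟩
      rw [e1]; nlinarith [hre.2]
    · obtain ⟨w, hw⟩ := hΦ.surjective ⟨⟨-(1 / 2), (Φ z).im⟩, (Φ z).im_pos⟩
      have e1 : (Φ w).re = -(1 / 2) := by rw [hw]; rfl
      refine ⟨w, (h.im_le_half hG hg (hG.inv_mem k hk) (fun e => hkg' (by rw [← e, inv_inv]))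
        (fun e => hkg (inv_injective e)) ((hΦ.gap_inv_nonpos_iff w).2 e1.le)).2, ?_, by rw [hw]; rfl⟩
      rw [e1]; nlinarith [hre.1]
  have c1 : Real.cosh (dist z w) ≤ 1 + 1 / 8 := by
    rw [← hΦ.isometry.dist_eq, cosh_dist_eq, hwim, sub_self]
    have : ((Φ z).re - (Φ w).re) ^ 2 / (2 * (Φ z).im * (Φ z).im) ≤ 1 / 8 := by
      rw [div_le_iff₀ (by nlinarith)]
      nlinarith
    simpa using this
  have c2 : 1 + 1 / 4 ≤ Real.cosh (dist z w) := by
    have hw0 := (Ψ w).im_pos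
    rw [← h.isometry.dist_eq, cosh_dist_eq]
    have : 1 / 4 ≤ (((Ψ z).re - (Ψ w).re) ^ 2 + ((Ψ z).im - (Ψ w).im) ^ 2) /
        (2 * (Ψ z).im * (Ψ w).im) := by
      rw [le_div_iff₀ (by positivity)]
      nlinarith [sq_nonneg ((Ψ z).re - (Ψ w).re),
        mul_pos (show 0 < (Ψ z).im - 2 * (Ψ w).im by linarith)
          (show 0 < (Ψ z).im - (Ψ w).im / 2 by linarith)]
    linarith
  linarith

/-- The distance travelled during `a + 1` windings around a cusp. -/
lemma two_mul_posLog_le (hg : g ∈ G) {z w : ℍ} (hz : z ∈ dirichlet G) (hw : w ∈ dirichlet G)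
    {Y Y' : ℝ} (hY : 1 ≤ Y) (hY' : 1 ≤ Y') (hzY : (Ψ z).im ≤ Y) (hwY : (Ψ w).im ≤ Y') (a : ℕ) :
    2 * Real.posLog (a : ℝ) ≤ dist z (g ^ (a + 1) • w) + Real.log Y + Real.log Y' := by
  have hl := Real.log_nonneg hY
  have hl' := Real.log_nonneg hY'
  rcases Nat.eq_zero_or_pos a with rfl | ha
  · simp only [Nat.cast_zero, Real.posLog_zero, mul_zero]
    positivity
  have ha' : (1 : ℝ) ≤ a := by exact_mod_cast ha
  have hYY : 0 < Y * Y' := by positivity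
  rw [Real.posLog_eq_log (by rwa [abs_of_nonneg (by linarith)])]
  set d := dist z (g ^ (a + 1) • w)
  have hre := abs_le.1 (h.abs_re_le hg hz)
  have hre' := abs_le.1 (h.abs_re_le hg hw)
  -- The real parts differ by at least `a`: the translation `a + 1` less two half-widths of the
  -- strip. Only the heights cause a loss.
  have hcosh : 1 + (a : ℝ) ^ 2 / (2 * (Y * Y')) ≤ Real.cosh d := by
    have i1 := (Ψ z).im_pos
    have i2 := (Ψ w).im_pos
    have e : d = dist (Ψ z) (Ψ (g ^ (a + 1) • w)) := (h.isometry.dist_eq _ _).symm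
    rw [e, cosh_dist_eq, h.re_pow_smul, h.im_pow_smul]
    have hnum : (a : ℝ) ^ 2 ≤ ((Ψ z).re - ((Ψ w).re + ((a + 1 : ℕ) : ℝ))) ^ 2 +
        ((Ψ z).im - (Ψ w).im) ^ 2 := by
      push_cast
      nlinarith [sq_nonneg ((Ψ z).im - (Ψ w).im)]
    have hden : 2 * (Ψ z).im * (Ψ w).im ≤ 2 * (Y * Y') := by
      have := mul_le_mul hzY hwY i2.le (by linarith)
      linarith
    gcongr
  have hexp : (a : ℝ) ^ 2 ≤ Real.exp d * (Y * Y') := by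
    have h1 : Real.cosh d ≤ (Real.exp d + 1) / 2 := by
      rw [Real.cosh_eq]
      have : Real.exp (-d) ≤ 1 := Real.exp_le_one_iff.2 (neg_nonpos.2 dist_nonneg)
      linarith
    have h2 : (a : ℝ) ^ 2 / (Y * Y') ≤ Real.exp d := by
      have e : (a : ℝ) ^ 2 / (2 * (Y * Y')) = (a : ℝ) ^ 2 / (Y * Y') / 2 := by
        rw [div_div, mul_comm 2]
      rw [e] at hcosh
      linarith
    rwa [div_le_iff₀ hYY] at h2
  have := Real.log_le_log (by positivity) hexp
  rw [Real.log_pow, Real.log_mul (Real.exp_pos d).ne' hYY.ne', Real.log_exp,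
    Real.log_mul (by linarith) (by linarith)] at this
  push_cast at this
  linarith

end IsCuspChart

end CuspWinding

namespace CuspWinding

/-! ### The winding numbers are bounded by the length -/

variable {G : Subgroup SL(2, ℝ)} {ω : ℕ → SL(2, ℝ)}

lemma smul_dirichlet_of_mem_Icc {g : SL(2, ℝ)} (hg : g ∈ G) {φ t τ t' : ℝ}
    (ht : polar t φ ∈ g • dirichlet G) (ht' : polar t' φ ∈ g • dirichlet G) (h1 : t ≤ τ)
    (h2 : τ ≤ t') : polar τ φ ∈ g • dirichlet G := by
  rw [mem_smul_dirichlet hg] at ht ht' ⊢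
  intro k hk
  exact gap_nonpos_iff.1 ((hypLinear_gap_polar (k • I) (g • I) φ).nonpos_of_mem_Icc
    (gap_nonpos_iff.2 (ht k hk)) (gap_nonpos_iff.2 (ht' k hk)) h1 h2)

lemma IsTreeLike.exists_crossing (hG : IsTreeLike G) (hω : IsReducedWord G ω) {j : ℕ} {D φ : ℝ}
    (hD : 0 ≤ D) (hj : wordGap ω j (polar D φ) ≤ 0) :
    ∃ t ∈ Set.Icc 0 D, wordGap ω j (polar t φ) = 0 := by
  have h0 : 0 < wordGap ω j (polar 0 φ) := by
    rw [polar_zero]; exact hG.wordGap_I_pos hω j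
  exact intermediate_value_Icc' hD (hypLinear_wordGap_polar ω j φ).continuous.continuousOn
    ⟨hj, h0.le⟩

lemma IsTreeLike.crossing_mono (hG : IsTreeLike G) (hω : IsReducedWord G ω) {i j : ℕ} (hij : i ≤ j)
    {φ t t' : ℝ} (ht' : 0 ≤ t') (hi : wordGap ω i (polar t φ) = 0)
    (hj : wordGap ω j (polar t' φ) ≤ 0) : t ≤ t' := by
  by_contra! hlt
  have h0 : 0 < wordGap ω i (polar 0 φ) := by
    rw [polar_zero]; exact hG.wordGap_I_pos hω i
  have := (hypLinear_wordGap_polar ω i φ).neg_of_pos_of_nonpos h0 ht'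
    (hG.wordGap_nonpos_of_le hω hij hj) hlt
  exact absurd hi this.ne

/-- A choice of charts at the cusps of the Dirichlet domain. -/
def IsCuspAtlas (G : Subgroup SL(2, ℝ)) (Ψ : SL(2, ℝ) → ℍ → ℍ) : Prop :=
  ∀ g ∈ sidePairings G, g.1.IsParabolic → IsCuspChart g (Ψ g)

lemma exists_isCuspAtlas (G : Subgroup SL(2, ℝ)) : ∃ Ψ, IsCuspAtlas G Ψ := by
  have (g : SL(2, ℝ)) : ∃ Ψ : ℍ → ℍ, g ∈ sidePairings G → g.1.IsParabolic → IsCuspChart g Ψ := by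
    by_cases hg : g.1.IsParabolic
    · obtain ⟨Ψ, h⟩ := exists_isCuspChart hg
      exact ⟨Ψ, fun _ _ => h⟩
    · exact ⟨id, fun _ h => absurd h hg⟩
  choose Ψ hΨ using this
  exact ⟨Ψ, hΨ⟩

/-- Between two different blocks, a geodesic visits the complement of the horoballs. -/
lemma IsTreeLike.exists_cut_point (hG : IsTreeLike G) (hω : IsReducedWord G ω)
    {Ψ : SL(2, ℝ) → ℍ → ℍ} (hΨ : IsCuspAtlas G Ψ) {j : ℕ}
    (hne : (ω j).1.IsParabolic → (ω (j + 1)).1.IsParabolic → ω (j + 1) ≠ ω j)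
    {φ t t' : ℝ} (htt' : t ≤ t') (ht : wordGap ω j (polar t φ) = 0)
    (ht' : wordGap ω (j + 1) (polar t' φ) = 0) :
    ∃ τ ∈ Set.Icc t t', (prefixProd ω (j + 1))⁻¹ • polar τ φ ∈ dirichlet G ∧
      ((ω j).1.IsParabolic → (Ψ (ω j) ((prefixProd ω (j + 1))⁻¹ • polar τ φ)).im ≤ 1) ∧
      ((ω (j + 1)).1.IsParabolic →
        (Ψ (ω (j + 1)) ((prefixProd ω (j + 1))⁻¹ • polar τ φ)).im ≤ 1) := by
  set W := prefixProd ω (j + 1)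
  have hF : polar t φ ∈ W • dirichlet G :=
    (hG.mem_smul_dirichlet_of_wordGap_eq_zero hω.mem ht).2
  have hF' : polar t' φ ∈ W • dirichlet G :=
    (hG.mem_smul_dirichlet_of_wordGap_eq_zero hω.mem ht').1
  have hW : W ∈ G := prefixProd_mem hω.mem _
  have hgt : gap I ((ω j)⁻¹ • I) (W⁻¹ • polar t φ) = 0 := by
    rwa [wordGap_eq', neg_eq_zero] at ht
  have hgt' : gap I (ω (j + 1) • I) (W⁻¹ • polar t' φ) = 0 := by
    rwa [wordGap_eq] at ht'
  have hinv : (ω j)⁻¹ ∈ sidePairings G := hG.inv_mem _ (hω.mem j)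
  -- At the exit the geodesic is low in the chart of `ω j`, at the entrance low in that of `ω (j +
  -- 1)`. If both letters are parabolic, the two closed conditions cover the segment by
  -- `im_le_one_or`, and connectedness gives a point satisfying both.
  have i1 (hp : (ω j).1.IsParabolic) (hne : ω (j + 1) ≠ ω j) :
      (Ψ (ω j) (W⁻¹ • polar t' φ)).im ≤ 1 := by
    have := ((hΨ _ (hω.mem j) hp).im_le_half hG (hω.mem j) (hω.mem (j + 1)) hne (hω.ne_inv j)
      hgt'.le).2
    linarith
  have i2 (hp : (ω (j + 1)).1.IsParabolic) (hne : ω (j + 1) ≠ ω j) :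
      (Ψ (ω (j + 1)) (W⁻¹ • polar t φ)).im ≤ 1 := by
    have := ((hΨ _ (hω.mem (j + 1)) hp).im_le_half hG (hω.mem (j + 1)) hinv (hω.ne_inv j).symm
      (fun e => hne (inv_injective e).symm) hgt.le).2
    linarith
  by_cases hp' : (ω (j + 1)).1.IsParabolic
  · by_cases hp : (ω j).1.IsParabolic
    · have hne' := hne hp hp'
      have hc {k : SL(2, ℝ)} (hk : IsCuspChart k (Ψ k)) :
          Continuous fun τ => (Ψ k (W⁻¹ • polar τ φ)).im :=
        UpperHalfPlane.continuous_im.comp (hk.isometry.continuous.comp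
          ((continuous_polar_left φ).const_smul _))
      obtain ⟨τ, hτ, h1, h2⟩ := isPreconnected_closed_iff.1 (isPreconnected_Icc (a := t) (b := t'))
        _ _ (isClosed_le (hc (hΨ _ (hω.mem j) hp)) continuous_const)
        (isClosed_le (hc (hΨ _ (hω.mem (j + 1)) hp')) continuous_const)
        (fun τ hτ => (hΨ _ (hω.mem j) hp).im_le_one_or hG (hω.mem j) (hΨ _ (hω.mem (j + 1)) hp')
          (hω.mem (j + 1)) hne' (hω.ne_inv j) (Set.mem_smul_set_iff_inv_smul_mem.1
            (smul_dirichlet_of_mem_Icc hW hF hF' hτ.1 hτ.2)))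
        ⟨t', Set.right_mem_Icc.2 htt', i1 hp hne'⟩ ⟨t, Set.left_mem_Icc.2 htt', i2 hp' hne'⟩
      exact ⟨τ, hτ, Set.mem_smul_set_iff_inv_smul_mem.1
        (smul_dirichlet_of_mem_Icc hW hF hF' hτ.1 hτ.2), fun _ => h1, fun _ => h2⟩
    · refine ⟨t, Set.left_mem_Icc.2 htt', Set.mem_smul_set_iff_inv_smul_mem.1 hF,
        fun h => absurd h hp, fun h => i2 h ?_⟩
      intro e
      exact hp (e ▸ h)
  · refine ⟨t', Set.right_mem_Icc.2 htt', Set.mem_smul_set_iff_inv_smul_mem.1 hF',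
      fun h => i1 h ?_, fun h => absurd h hp'⟩
    intro e
    exact hp' (e ▸ h)

lemma not_isParabolic_of_isHyperbolic {g : SL(2, ℝ)} (h : g.1.IsHyperbolic) :
    ¬ g.1.IsParabolic := fun h' => absurd h'.2 (ne_of_gt h)

namespace IsBlockDecomposition

variable {N : ℕ → ℕ} (hN : IsBlockDecomposition ω N)
include hN

lemma lt_succ (k : ℕ) : N k < N (k + 1) := by
  rcases hN.2 k with h | h
  · omega
  · exact h.2.1

lemma strictMono : StrictMono N := strictMono_nat_of_lt_succ hN.lt_succ

lemma eq_of_mem_block {k m : ℕ} (h1 : N k ≤ m) (h2 : m < N (k + 1)) : ω m = ω (N k) := by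
  rcases hN.2 k with h | h
  · congr 1; omega
  · exact h.2.2.1 m h1 h2

lemma prefixProd_succ (k : ℕ) :
    prefixProd ω (N (k + 1)) = prefixProd ω (N k) * ω (N k) ^ (cuspWinding N k + 1) := by
  have key (i : ℕ) (hi : N k + i ≤ N (k + 1)) :
      prefixProd ω (N k + i) = prefixProd ω (N k) * ω (N k) ^ i := by
    induction i with
    | zero => simp
    | succ i ih =>
      rw [← add_assoc, CuspWinding.prefixProd_succ, ih (by omega),
        hN.eq_of_mem_block (by omega) (by omega : N k + i < N (k + 1)), pow_succ, mul_assoc]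
  have := hN.lt_succ k
  have h := key (N (k + 1) - N k) (by omega)
  rw [show N k + (N (k + 1) - N k) = N (k + 1) by omega] at h
  rw [h, cuspWinding]
  congr 2
  omega

lemma last_ne {k j : ℕ} (hj : N (k + 1) = j + 1) (hp : (ω j).1.IsParabolic) : ω (j + 1) ≠ ω j := by
  have := hN.lt_succ k
  have e : ω j = ω (N k) := hN.eq_of_mem_block (by omega) (by omega)
  rcases hN.2 k with h | h
  · exact absurd (e ▸ hp) (not_isParabolic_of_isHyperbolic h.1)
  · rw [e, ← hj]; exact h.2.2.2

lemma cuspWinding_eq_zero_of_not_isParabolic {k : ℕ} (h : ¬ (ω (N k)).1.IsParabolic) :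
    cuspWinding N k = 0 := by
  rcases hN.2 k with h' | h'
  · rw [cuspWinding]; omega
  · exact absurd h'.1 h

end IsBlockDecomposition

lemma I_mem_dirichlet (G : Subgroup SL(2, ℝ)) : I ∈ dirichlet G := fun g _ => by
  rw [dist_self]; exact dist_nonneg

/-- The logarithmic winding numbers are bounded by the displacement, up to a constant. -/
theorem IsTreeLike.exists_sum_posLog_le (hG : IsTreeLike G) : ∃ C : ℝ, ∀ ω N, IsReducedWord G ω →
    IsBlockDecomposition ω N → ∀ n, 2 * ∑ k ∈ Finset.range n, Real.posLog (cuspWinding N k : ℝ) ≤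
      dist I (prefixProd ω (N n) • I) + C := by
  obtain ⟨Ψ, hΨ⟩ := exists_isCuspAtlas G
  obtain ⟨Y₀, hY₀⟩ := (hG.finite_sidePairings.image fun g => (Ψ g I).im).bddAbove
  set Y := max 1 Y₀
  have hY1 : 1 ≤ Y := le_max_left _ _
  have hY (g : SL(2, ℝ)) (hg : g ∈ sidePairings G) : (Ψ g I).im ≤ Y :=
    (hY₀ ⟨g, hg, rfl⟩).trans (le_max_right _ _)
  have hlY := Real.log_nonneg hY1
  refine ⟨Real.log Y + Real.log Y, fun ω N hω hN n => ?_⟩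
  rcases Nat.eq_zero_or_pos n with rfl | hn
  · simp only [Finset.range_zero, Finset.sum_empty, mul_zero]
    positivity
  set D := dist I (prefixProd ω (N n) • I)
  have hD : 0 ≤ D := dist_nonneg
  obtain ⟨φ, -, hφ⟩ := exists_eq_polar (prefixProd ω (N n) • I)
  change _ = polar D φ at hφ
  have hcross (j : ℕ) (hj : j < N n) : ∃ t ∈ Set.Icc 0 D, wordGap ω j (polar t φ) = 0 :=
    hG.exists_crossing hω hD (hφ ▸ hG.wordGap_prefixProd_nonpos hω hj)
  choose! t ht ht0 using hcross
  have hNlt {k : ℕ} (hk : k < n) : N k < N n := hN.strictMono hk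
  have hNpos {k : ℕ} (hk : 0 < k) : 0 < N k := (Nat.zero_le _).trans_lt (hN.strictMono hk)
  have hNle {k : ℕ} (hk : k ≤ n) : N k ≤ N n := hN.strictMono.monotone hk
  -- Height bounds at the cut points. Interior ones get `1`, whose logarithm vanishes; the two ends
  -- are orbit points of `I` and need `Y`. Below, `N k - 1` is the last letter before block `k`.
  set y : ℕ → ℝ := fun k => if k = 0 then Y else 1
  set y' : ℕ → ℝ := fun k => if k = n then Y else 1
  have hy1 (k : ℕ) : 1 ≤ y k := by simp only [y]; split_ifs <;> simp [hY1]
  have hy1' (k : ℕ) : 1 ≤ y' k := by simp only [y']; split_ifs <;> simp [hY1]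
  have hcut (k : ℕ) (hk : k ≤ n) : ∃ τ ∈ Set.Icc 0 D,
      (prefixProd ω (N k))⁻¹ • polar τ φ ∈ dirichlet G ∧
      (k < n → (ω (N k)).1.IsParabolic →
        (Ψ (ω (N k)) ((prefixProd ω (N k))⁻¹ • polar τ φ)).im ≤ y k) ∧
      (0 < k → (ω (N k - 1)).1.IsParabolic →
        (Ψ (ω (N k - 1)) ((prefixProd ω (N k))⁻¹ • polar τ φ)).im ≤ y' k) ∧
      (0 < k → t (N k - 1) ≤ τ) ∧ (k < n → τ ≤ t (N k)) ∧ (k = 0 → τ = 0) ∧ (k = n → τ = D) := by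
    rcases Nat.eq_zero_or_pos k with rfl | hk0
    · refine ⟨0, ⟨le_rfl, hD⟩, ?_, fun _ _ => ?_, fun h => absurd h (lt_irrefl _),
        fun h => absurd h (lt_irrefl _), fun h => (ht _ (hNlt h)).1, fun _ => rfl,
        fun h => absurd h hn.ne⟩
      · rw [hN.1, prefixProd_zero, inv_one, one_smul, polar_zero]; exact I_mem_dirichlet G
      · rw [polar_zero]
        rw [hN.1, prefixProd_zero, inv_one, one_smul]
        simpa [y] using hY _ (hω.mem 0)
    rcases hk.eq_or_lt with rfl | hkn
    · refine ⟨D, ⟨hD, le_rfl⟩, ?_, fun h => absurd h (lt_irrefl _), fun _ _ => ?_,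
        fun h => (ht _ ?_).2, fun h => absurd h (lt_irrefl _), fun h => absurd h hk0.ne',
        fun _ => rfl⟩
      · rw [← hφ, inv_smul_smul]; exact I_mem_dirichlet G
      · rw [← hφ, inv_smul_smul]
        simpa [y'] using hY _ (hω.mem _)
      · have := hNpos hk0
        omega
    · obtain ⟨j, hj⟩ : ∃ j, N k = j + 1 := ⟨N k - 1, by have := hNpos hk0; omega⟩
      obtain ⟨k', rfl⟩ : ∃ k', k = k' + 1 := ⟨k - 1, by omega⟩
      have hjn : j + 1 < N n := hj ▸ hNlt hkn
      have htj := ht _ hjn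
      obtain ⟨τ, hτ, h1, h2, h3⟩ := hG.exists_cut_point hω hΨ (fun hp _ => hN.last_ne hj hp)
        (hG.crossing_mono hω (Nat.le_succ j) htj.1 (ht0 j (by omega)) (ht0 _ hjn).le)
        (ht0 j (by omega)) (ht0 _ hjn)
      rw [hj, Nat.add_sub_cancel]
      refine ⟨τ, ⟨(ht j (by omega)).1.trans hτ.1, hτ.2.trans htj.2⟩, h1,
        fun _ hp => (h3 hp).trans (hy1 _), fun _ hp => (h2 hp).trans (hy1' _), fun _ => hτ.1,
        fun _ => hτ.2, fun h => absurd h (by omega), fun h => absurd h hkn.ne⟩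
  choose! τ hτ hτF hτy hτy' hτl hτr hτ0 hτn using hcut
  have hstep (k : ℕ) (hk : k ∈ Finset.range n) : 2 * Real.posLog (cuspWinding N k : ℝ) ≤
      (τ (k + 1) - τ k) + Real.log (y k) + Real.log (y' (k + 1)) := by
    have hkn : k < n := Finset.mem_range.1 hk
    have hkN := hN.lt_succ k
    have hkN' : N (k + 1) ≤ N n := hNle hkn
    have hmono : τ k ≤ τ (k + 1) := by
      refine (hτr k hkn.le hkn).trans (le_trans ?_ (hτl (k + 1) hkn (Nat.succ_pos k)))
      exact hG.crossing_mono hω (by omega : N k ≤ N (k + 1) - 1) (ht _ (by omega)).1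
        (ht0 _ (by omega)) (ht0 _ (by omega)).le
    by_cases hp : (ω (N k)).1.IsParabolic
    · have hω1 : ω (N (k + 1) - 1) = ω (N k) := hN.eq_of_mem_block (by omega) (by omega)
      have h2 := hτy' (k + 1) hkn (Nat.succ_pos k)
      rw [hω1] at h2
      have := (hΨ _ (hω.mem (N k)) hp).two_mul_posLog_le (hω.mem (N k)).1 (hτF k hkn.le)
        (hτF (k + 1) hkn) (hy1 k) (hy1' (k + 1)) (hτy k hkn.le hkn hp) (h2 hp) (cuspWinding N k)
      refine this.trans (le_of_eq ?_)
      congr 2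
      rw [hN.prefixProd_succ, mul_inv_rev, mul_smul, smul_inv_smul, dist_smul, dist_polar_polar,
        abs_sub_comm, abs_of_nonneg (by linarith)]
    · rw [hN.cuspWinding_eq_zero_of_not_isParabolic hp]
      have h1 := Real.log_nonneg (hy1 k)
      have h2 := Real.log_nonneg (hy1' (k + 1))
      simp only [Nat.cast_zero, Real.posLog_zero, mul_zero]
      linarith
  rw [Finset.mul_sum]
  refine (Finset.sum_le_sum hstep).trans (le_of_eq ?_)
  rw [Finset.sum_add_distrib, Finset.sum_add_distrib, Finset.sum_range_sub, hτ0 0 hn.le rfl,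
    hτn n le_rfl rfl]
  have s1 : ∑ k ∈ Finset.range n, Real.log (y k) = Real.log Y := by
    rw [Finset.sum_eq_single_of_mem 0 (Finset.mem_range.2 hn)]
    · simp [y]
    · intro b _ hb
      simp [y, hb]
  have s2 : ∑ k ∈ Finset.range n, Real.log (y' (k + 1)) = Real.log Y := by
    rw [Finset.sum_eq_single_of_mem (n - 1) (Finset.mem_range.2 (by omega))]
    · simp [y', Nat.sub_add_cancel hn]
    · intro b hb hbn
      rw [Finset.mem_range] at hb
      have : b + 1 ≠ n := by omega
      simp [y', this]
  rw [s1, s2, sub_zero, add_assoc]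

theorem IsTreeLike.mem_Icc_of_levelSet_nonempty (hG : IsTreeLike G) {α : ℝ}
    (h : (levelSet G α).Nonempty) : α ∈ Set.Icc (0 : ℝ) 1 := by
  obtain ⟨x, -, ω, N, hexp, hN, hlim⟩ := h
  have hω := hexp.isReducedWord hG
  obtain ⟨C, hC⟩ := hG.exists_sum_posLog_le
  have hsum (n : ℕ) : 0 ≤ ∑ k ∈ Finset.range n, Real.posLog (cuspWinding N k : ℝ) :=
    Finset.sum_nonneg fun _ _ => Real.posLog_nonneg
  refine ⟨ge_of_tendsto' hlim fun n => div_nonneg (mul_nonneg zero_le_two (hsum n)) dist_nonneg, ?_⟩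
  have hD : Tendsto (fun n => dist (prefixProd ω (N n) • I) I) atTop atTop := by
    simp_rw [dist_comm _ I]
    exact (hG.tendsto_dist_prefixProd hω).comp hN.strictMono.tendsto_atTop
  have hlim' : Tendsto (fun n => 1 + C / dist (prefixProd ω (N n) • I) I) atTop (𝓝 (1 + 0)) :=
    tendsto_const_nhds.add (tendsto_const_nhds.div_atTop hD)
  rw [add_zero] at hlim'
  refine le_of_tendsto_of_tendsto hlim hlim' ?_
  filter_upwards [hD.eventually_gt_atTop 0] with n hn
  rw [div_le_iff₀ hn, add_mul, div_mul_cancel₀ _ hn.ne', one_mul]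
  have := hC ω N hω hN n
  rwa [dist_comm I] at this

end CuspWinding

namespace CuspWinding

/-! ### Boundary points with a prescribed word -/

lemma polar_coe (t φ : ℝ) : ((polar t φ : ℍ) : ℂ) = ((polar t φ).re : ℂ) +
    ((polar t φ).im : ℂ) * Complex.I := (Complex.re_add_im _).symm

/-- The endpoint is `sin φ / (1 - cos φ)`, or infinity when `cos φ = 1`. Everything is rewritten in
`exp (-t)` so that the limits can be read off. -/
lemma exists_isRayTo_polar (φ : ℝ) : ∃ x, IsRayTo (fun t : ℝ≥0 => polar t φ) x := by
  have hiso : Isometry fun t : ℝ≥0 => polar t φ := Isometry.of_dist_eq fun s t => by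
    rw [dist_polar_polar, NNReal.dist_eq]
  have h0 : polar ((0 : ℝ≥0) : ℝ) φ = I := by rw [NNReal.coe_zero, polar_zero]
  have hat : Tendsto (fun t : ℝ≥0 => (t : ℝ)) atTop atTop := NNReal.tendsto_coe_atTop.2 tendsto_id
  have hexp : Tendsto (fun t : ℝ≥0 => Real.exp (-t)) atTop (𝓝 0) :=
    Real.tendsto_exp_neg_atTop_nhds_zero.comp hat
  have hden (t : ℝ) : Real.cosh t - Real.sinh t * Real.cos φ =
      Real.exp t * ((1 + Real.exp (-t) ^ 2) - (1 - Real.exp (-t) ^ 2) * Real.cos φ) / 2 := by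
    have := Real.exp_ne_zero t
    rw [Real.cosh_eq, Real.sinh_eq, Real.exp_neg]
    field_simp
  rcases eq_or_ne (Real.cos φ) 1 with hc | hc
  · refine ⟨∞, hiso, h0, ?_⟩
    have hn : Tendsto (fun t : ℝ≥0 => ((polar t φ : ℍ) : ℂ)) atTop (cocompact ℂ) := by
      rw [← Metric.cobounded_eq_cocompact, ← tendsto_norm_atTop_iff_cobounded]
      refine tendsto_atTop_mono (f := fun t : ℝ≥0 => Real.exp t) (fun t => ?_)
        (Real.tendsto_exp_atTop.comp hat)
      refine le_trans (le_of_eq ?_) (Complex.abs_im_le_norm _)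
      rw [coe_im, polar_im, hc, mul_one, Real.cosh_sub_sinh, Real.exp_neg, inv_inv,
        abs_of_pos (Real.exp_pos _)]
    rw [OnePoint.map_infty]
    refine Tendsto.comp (g := ((↑) : ℂ → OnePoint ℂ)) ?_ hn
    rw [← coclosedCompact_eq_cocompact]
    exact OnePoint.tendsto_coe_infty
  · refine ⟨((Real.sin φ / (1 - Real.cos φ) : ℝ) : OnePoint ℝ), hiso, h0, ?_⟩
    have h1 : 1 - Real.cos φ ≠ 0 := sub_ne_zero.2 hc.symm
    rw [OnePoint.map_some]
    refine (OnePoint.continuous_coe.tendsto _).comp ?_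
    have hlim : Tendsto (fun t : ℝ≥0 => (1 + Real.exp (-t) ^ 2) -
        (1 - Real.exp (-t) ^ 2) * Real.cos φ) atTop (𝓝 (1 - Real.cos φ)) := by
      have : Tendsto (fun t : ℝ≥0 => (1 + Real.exp (-t) ^ 2) -
        (1 - Real.exp (-t) ^ 2) * Real.cos φ) atTop
          (𝓝 ((1 + (0 : ℝ) ^ 2) - (1 - (0 : ℝ) ^ 2) * Real.cos φ)) :=
        ((hexp.pow 2).const_add 1).sub (((hexp.pow 2).const_sub 1).mul_const _)
      simpa using this
    have hre : Tendsto (fun t : ℝ≥0 => (polar t φ).re) atTop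
        (𝓝 (Real.sin φ / (1 - Real.cos φ))) := by
      have : Tendsto (fun t : ℝ≥0 => (1 - Real.exp (-t) ^ 2) * Real.sin φ /
          ((1 + Real.exp (-t) ^ 2) - (1 - Real.exp (-t) ^ 2) * Real.cos φ)) atTop
          (𝓝 ((1 - (0 : ℝ) ^ 2) * Real.sin φ / (1 - Real.cos φ))) :=
        (((hexp.pow 2).const_sub 1).mul_const _).div hlim h1
      simp only [ne_eq, OfNat.ofNat_ne_zero, not_false_eq_true, zero_pow, sub_zero, one_mul] at this
      refine this.congr fun t => ?_
      have e1 := Real.exp_ne_zero t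
      have e2 : Real.sinh t = Real.exp t * (1 - Real.exp (-t) ^ 2) / 2 := by
        rw [Real.sinh_eq, Real.exp_neg]
        field_simp
      rw [polar_re, hden, e2]
      have e3 := cosh_sub_sinh_mul_cos_pos t φ
      rw [hden] at e3
      have e4 : (1 + Real.exp (-t) ^ 2) - (1 - Real.exp (-t) ^ 2) * Real.cos φ ≠ 0 := by
        intro h
        rw [h] at e3
        simp at e3
      field_simp
    have him : Tendsto (fun t : ℝ≥0 => (polar t φ).im) atTop (𝓝 0) := by
      have : Tendsto (fun t : ℝ≥0 => 2 * Real.exp (-t) /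
          ((1 + Real.exp (-t) ^ 2) - (1 - Real.exp (-t) ^ 2) * Real.cos φ)) atTop
          (𝓝 (2 * 0 / (1 - Real.cos φ))) := (hexp.const_mul 2).div hlim h1
      rw [mul_zero, zero_div] at this
      refine this.congr fun t => ?_
      rw [polar_im, hden, inv_div, Real.exp_neg]
      have := Real.exp_ne_zero t
      rw [← div_div, div_eq_mul_inv 2]
    have hC := ((Complex.continuous_ofReal.tendsto _).comp hre).add
      (((Complex.continuous_ofReal.tendsto _).comp him).mul_const Complex.I)
    simp only [Function.comp_def, Complex.ofReal_zero, zero_mul, add_zero] at hC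
    refine hC.congr fun t => ?_
    rw [polar_coe]

variable {G : Subgroup SL(2, ℝ)} {ω : ℕ → SL(2, ℝ)}

/-- Midway between the two lines `Re = 1/2` and `Re = 3/2`, a geodesic crossing both of them has
height at least `1/2`. -/
lemma half_le_im_of_hypLinear {ζ : ℝ → ℍ} (hζ : ∀ w, HypLinear fun t => Real.cosh (dist (ζ t) w))
    {t₀ s t₁ : ℝ} (h0s : t₀ ≤ s) (hs1 : s ≤ t₁) (h0 : (ζ t₀).re = 1 / 2) (hs : (ζ s).re = 1)
    (h1 : (ζ t₁).re = 3 / 2) : 1 / 2 ≤ (ζ s).im := by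
  have c1 := hζ I
  have c2 := hζ ⟨⟨0, 2⟩, two_pos⟩
  have c3 := hζ ⟨⟨1, 1⟩, one_pos⟩
  have e1 (t : ℝ) : Real.cosh (dist (ζ t) I) =
      ((ζ t).re ^ 2 + (ζ t).im ^ 2 + 1) / (2 * (ζ t).im) := by
    rw [dist_comm, cosh_dist_I]
  have e2 (t : ℝ) : Real.cosh (dist (ζ t) ⟨⟨0, 2⟩, two_pos⟩) =
      ((ζ t).re ^ 2 + (ζ t).im ^ 2 + 4) / (4 * (ζ t).im) := by
    have := (ζ t).im_pos
    rw [cosh_dist_eq]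
    change 1 + (((ζ t).re - 0) ^ 2 + ((ζ t).im - 2) ^ 2) / (2 * (ζ t).im * 2) = _
    field_simp
    ring
  have e3 (t : ℝ) : Real.cosh (dist (ζ t) ⟨⟨1, 1⟩, one_pos⟩) =
      (((ζ t).re - 1) ^ 2 + (ζ t).im ^ 2 + 1) / (2 * (ζ t).im) := by
    have := (ζ t).im_pos
    rw [cosh_dist_eq]
    change 1 + (((ζ t).re - 1) ^ 2 + ((ζ t).im - 1) ^ 2) / (2 * (ζ t).im * 1) = _
    field_simp
    ring
  -- The functions `1 / im`, `re / im` and `(re ^ 2 + im ^ 2) / im` are linear on the hyperboloid,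
  -- so distances to three points determine them linearly.
  have lA : HypLinear fun t => 1 / (ζ t).im := by
    convert (c2.const_mul (4 / 3)).sub (c1.const_mul (2 / 3)) using 2 with t
    have := (ζ t).im_pos
    rw [e1, e2]
    field_simp
    ring
  have lE : HypLinear fun t => ((ζ t).re ^ 2 + (ζ t).im ^ 2) / (ζ t).im := by
    convert (c1.const_mul 2).sub lA using 2 with t
    have := (ζ t).im_pos
    rw [e1]
    field_simp
    ring
  have lB : HypLinear fun t => (ζ t).re / (ζ t).im := by
    convert (c1.sub c3).sub (lA.const_mul (-1 / 2)) using 2 with t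
    have := (ζ t).im_pos
    rw [e1, e3]
    field_simp
    ring
  have hA := lA.three_point t₀ s t₁
  have hB := lB.three_point t₀ s t₁
  have hE := lE.three_point t₀ s t₁
  rw [h0, h1, hs] at hB hE
  have y0 := (ζ t₀).im_pos
  have y1 := (ζ t₁).im_pos
  have ys := (ζ s).im_pos
  set a := (ζ t₀).im
  set b := (ζ t₁).im
  set y := (ζ s).im
  have h01 : t₀ < t₁ := by
    rcases (h0s.trans hs1).eq_or_lt with h | h
    · rw [← h, h0] at h1; norm_num at h1
    · exact h
  have sp : 0 < Real.sinh (t₁ - t₀) := Real.sinh_pos_iff.2 (by linarith)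
  set p := Real.sinh (t₁ - s) / a with hp
  set q := Real.sinh (s - t₀) / b with hq
  set r := Real.sinh (t₁ - t₀) / y with hr
  have hrpos : 0 < r := div_pos sp ys
  have A' : r = p + q := by rw [hr, hp, hq]; linear_combination hA
  have B' : r = p / 2 + 3 * q / 2 := by rw [hr, hp, hq]; linear_combination hB
  have E' : r * (1 + y ^ 2) = p * (1 / 4 + a ^ 2) + q * (9 / 4 + b ^ 2) := by
    rw [hr, hp, hq]; linear_combination hE
  -- The first two coordinates force equal weights; the third then reads `y ^ 2 = 1 / 4 + (a ^ 2 + b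
  -- ^ 2) / 2`.
  have hpq : p = q := by linarith
  have hy : 2 * p * (y ^ 2 - 1 / 4) = p * (a ^ 2 + b ^ 2) := by
    rw [A', ← hpq] at E'
    linear_combination E'
  have hppos : 0 < p := by linarith
  have : y ^ 2 - 1 / 4 = (a ^ 2 + b ^ 2) / 2 := by
    have := mul_left_cancel₀ hppos.ne' (show p * (2 * (y ^ 2 - 1 / 4)) = p * (a ^ 2 + b ^ 2) by
      linarith)
    linarith
  nlinarith [sq_nonneg a, sq_nonneg b]

/-- If a word contains a run `γγ` of parabolic letters followed by a different letter, then the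
corresponding geodesics pass at bounded distance from the orbit. -/
lemma IsTreeLike.exists_dist_le (hG : IsTreeLike G) {γ : SL(2, ℝ)} (hγ : γ ∈ sidePairings G)
    (hp : γ.1.IsParabolic) : ∃ R : ℝ, ∀ ω, IsReducedWord G ω → ∀ j, ω j = γ → ω (j + 1) = γ →
      ω (j + 2) ≠ γ → ∀ D φ : ℝ, 0 ≤ D → wordGap ω (j + 2) (polar D φ) ≤ 0 →
        ∃ t, 0 ≤ t ∧ wordGap ω j (polar t φ) ≤ 0 ∧ dist (polar t φ) (prefixProd ω j • I) ≤ R := by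
  obtain ⟨Ψ, hΨ⟩ := exists_isCuspChart hp
  set b := (Ψ I).im
  have hb : 0 < b := (Ψ I).im_pos
  -- This bounds `cosh` of the distance, hence the distance, from `Ψ I` to a point of height `1 / 2`
  -- with real part at most `3` in modulus.
  refine ⟨1 + (9 + (1 / 2 - b) ^ 2) / b, fun ω hω j hj0 hj1 hj2 D φ hD hgap => ?_⟩
  obtain ⟨t₂, ht₂, h₂⟩ := hG.exists_crossing hω hD hgap
  obtain ⟨t₁, ht₁, h₁⟩ := hG.exists_crossing hω ht₂.1
    (hG.wordGap_nonpos_of_le hω (Nat.le_succ (j + 1)) h₂.le)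
  obtain ⟨t₀, ht₀, h₀⟩ := hG.exists_crossing hω ht₁.1
    (hG.wordGap_nonpos_of_le hω (Nat.le_succ j) h₁.le)
  set W := prefixProd ω j
  have hW1 : prefixProd ω (j + 1) = W * γ := by rw [prefixProd_succ, hj0]
  have hW2 : prefixProd ω (j + 2) = W * γ * γ := by
    rw [show j + 2 = (j + 1) + 1 from rfl, prefixProd_succ, hW1, hj1]
  set ζ : ℝ → ℍ := fun t => Ψ (W⁻¹ • polar t φ) with hζ
  have hζlin (w : ℍ) : HypLinear fun t => Real.cosh (dist (ζ t) w) := by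
    obtain ⟨w, rfl⟩ := hΨ.surjective w
    have e (t : ℝ) : dist (ζ t) (Ψ w) = dist (polar t φ) (W • w) := by
      rw [hζ, hΨ.isometry.dist_eq, ← dist_smul W, smul_inv_smul]
    simp only [e]
    exact hypLinear_cosh_dist_polar φ _
  have hζc : Continuous ζ :=
    hΨ.isometry.continuous.comp ((continuous_polar_left φ).const_smul _)
  have hrec (z : ℍ) : (Ψ z).re = (Ψ (γ⁻¹ • z)).re + 1 ∧ (Ψ z).im = (Ψ (γ⁻¹ • z)).im := by
    have r1 := hΨ.re_smul (γ⁻¹ • z)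
    have r2 := hΨ.im_smul (γ⁻¹ • z)
    rw [smul_inv_smul] at r1 r2
    exact ⟨r1, r2⟩
  have hre1 (t : ℝ) : (ζ t).re = (Ψ ((W * γ)⁻¹ • polar t φ)).re + 1 := by
    rw [mul_inv_rev, mul_smul]; exact (hrec _).1
  have hre2 (t : ℝ) : (ζ t).re = (Ψ ((W * γ * γ)⁻¹ • polar t φ)).re + 2 ∧
      (ζ t).im = (Ψ ((W * γ * γ)⁻¹ • polar t φ)).im := by
    rw [mul_inv_rev, mul_inv_rev, mul_smul, mul_smul]
    refine ⟨?_, ?_⟩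
    · rw [hζ]; dsimp only; rw [(hrec (W⁻¹ • polar t φ)).1, (hrec (γ⁻¹ • W⁻¹ • polar t φ)).1]; ring
    · rw [hζ]; dsimp only; rw [(hrec (W⁻¹ • polar t φ)).2, (hrec (γ⁻¹ • W⁻¹ • polar t φ)).2]
  have hhalf {z : ℍ} (hz : gap I (γ • I) z = 0) : (Ψ z).re = 1 / 2 :=
    le_antisymm ((hΨ.gap_nonneg_iff z).1 hz.ge) ((hΨ.gap_nonpos_iff z).1 hz.le)
  have r0 : (ζ t₀).re = 1 / 2 := by
    rw [wordGap_eq, hj0] at h₀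
    exact hhalf h₀
  have r1 : (ζ t₁).re = 3 / 2 := by
    have h := h₁
    rw [wordGap_eq, hj1, hW1] at h
    rw [hre1, hhalf h]; norm_num
  have hne : ω (j + 2) ≠ γ⁻¹ := hj1 ▸ hω.ne_inv (j + 1)
  have i2 : (ζ t₂).im ≤ 1 / 2 := by
    have h := h₂
    rw [wordGap_eq, hW2] at h
    rw [(hre2 t₂).2]
    exact (hΨ.im_le_half hG hγ (hω.mem _) hj2 hne h.le).2
  have hbound (t : ℝ) (h1 : t₀ ≤ t) (h2 : t ≤ t₂) : |(ζ t).re| ≤ 3 := by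
    rcases le_total t t₁ with h | h
    · have := smul_dirichlet_of_mem_Icc (prefixProd_mem hω.mem _)
        (hG.mem_smul_dirichlet_of_wordGap_eq_zero hω.mem h₀).2
        (hG.mem_smul_dirichlet_of_wordGap_eq_zero hω.mem h₁).1 h1 h
      rw [Set.mem_smul_set_iff_inv_smul_mem, hW1] at this
      have := abs_le.1 (hΨ.abs_re_le hγ.1 this)
      rw [hre1, abs_le]
      constructor <;> linarith [this.1, this.2]
    · have := smul_dirichlet_of_mem_Icc (prefixProd_mem hω.mem _)
        (hG.mem_smul_dirichlet_of_wordGap_eq_zero hω.mem h₁).2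
        (hG.mem_smul_dirichlet_of_wordGap_eq_zero hω.mem h₂).1 h h2
      rw [Set.mem_smul_set_iff_inv_smul_mem, show j + 1 + 1 = j + 2 from rfl, hW2] at this
      have := abs_le.1 (hΨ.abs_re_le hγ.1 this)
      rw [(hre2 t).1, abs_le]
      constructor <;> linarith [this.1, this.2]
  -- Where the real part is `1` the height is at least `1 / 2`; on the side `ω (j + 2)` it is at
  -- most `1 / 2`. In between it equals `1 / 2`.
  obtain ⟨s, hs, hs1⟩ := intermediate_value_Icc ht₀.2
    (UpperHalfPlane.continuous_re.comp hζc).continuousOn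
    (show (1 : ℝ) ∈ Set.Icc ((ζ t₀).re) ((ζ t₁).re) by rw [r0, r1]; norm_num)
  have is : 1 / 2 ≤ (ζ s).im := half_le_im_of_hypLinear hζlin hs.1 hs.2 r0 hs1 r1
  obtain ⟨t, ht, hti⟩ := intermediate_value_Icc' (hs.2.trans ht₁.2)
    (UpperHalfPlane.continuous_im.comp hζc).continuousOn ⟨i2, is⟩
  change (ζ t).im = 1 / 2 at hti
  refine ⟨t, ht₀.1.trans (hs.1.trans ht.1), ?_, ?_⟩
  · rcases (hs.1.trans ht.1).eq_or_lt with h | h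
    · rw [← h, h₀]
    · refine ((hypLinear_wordGap_polar ω j φ).neg_of_pos_of_nonpos (t₀ := 0) ?_ ht₀.1 h₀.le h).le
      rw [polar_zero]; exact hG.wordGap_I_pos hω j
  · have e : dist (polar t φ) (W • I) = dist (ζ t) (Ψ I) := by
      rw [hζ, hΨ.isometry.dist_eq, ← dist_smul W (W⁻¹ • polar t φ), smul_inv_smul]
    rw [e]
    have h1 : dist (ζ t) (Ψ I) ≤ Real.cosh (dist (ζ t) (Ψ I)) :=
      (Real.self_le_sinh_iff.2 dist_nonneg).trans (Real.sinh_lt_cosh _).le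
    refine h1.trans ?_
    rw [cosh_dist_eq, hti, hΨ.re_I, sub_zero, show 2 * (1 / 2 : ℝ) * (Ψ I).im = b by ring]
    have h3 := abs_le.1 (hbound t (hs.1.trans ht.1) ht.2)
    have h9 : (ζ t).re ^ 2 ≤ 9 := by nlinarith [h3.1, h3.2]
    gcongr

/-- A reduced word that contains infinitely many runs of at least two parabolic letters `γ` is the
word of a radial limit point. -/
theorem IsTreeLike.exists_isExpansion (hG : IsTreeLike G) (hω : IsReducedWord G ω) {γ : SL(2, ℝ)}
    (hγ : γ ∈ sidePairings G) (hp : γ.1.IsParabolic)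
    (hrun : ∀ n, ∃ j ≥ n, ω j = γ ∧ ω (j + 1) = γ ∧ ω (j + 2) ≠ γ) :
    ∃ x ∈ radialLimitSet G, IsExpansion G x ω := by
  obtain ⟨R, hR⟩ := hG.exists_dist_le hγ hp
  choose φ hφ hφeq using fun m => exists_eq_polar (prefixProd ω m • I)
  obtain ⟨ψ, hψ, f, hf, hlim⟩ := isCompact_Icc.tendsto_subseq hφ
  have key (j : ℕ) (h0 : ω j = γ) (h1 : ω (j + 1) = γ) (h2 : ω (j + 2) ≠ γ) :
      ∃ t, 0 ≤ t ∧ wordGap ω j (polar t ψ) ≤ 0 ∧ dist (polar t ψ) (prefixProd ω j • I) ≤ R := by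
    -- The bound `R` confines `t` to a compact interval, so the point beyond side `j` survives in
    -- the limiting direction instead of escaping to infinity.
    set A : Set (ℝ × ℝ) := (Set.Icc 0 (dist I (prefixProd ω j • I) + R) ×ˢ
      Set.Icc (-Real.pi) Real.pi) ∩ ({p | wordGap ω j (polar p.1 p.2) ≤ 0} ∩
        {p | dist (polar p.1 p.2) (prefixProd ω j • I) ≤ R})
    have hA : IsCompact A := (isCompact_Icc.prod isCompact_Icc).inter_right
      ((isClosed_le ((continuous_wordGap ω j).comp continuous_polar) continuous_const).inter
        (isClosed_le (continuous_polar.dist continuous_const) continuous_const))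
    have hmem : ∀ᶠ m in atTop, φ (f m) ∈ Prod.snd '' A := by
      filter_upwards [hf.tendsto_atTop.eventually_ge_atTop (j + 3)] with m hm
      obtain ⟨t, ht, ht1, ht2⟩ := hR ω hω j h0 h1 h2 (dist I (prefixProd ω (f m) • I)) (φ (f m))
        dist_nonneg (by rw [← hφeq]; exact hG.wordGap_prefixProd_nonpos hω (by omega))
      refine ⟨(t, φ (f m)), ⟨⟨⟨ht, ?_⟩, hφ _⟩, ht1, ht2⟩, rfl⟩
      have h3 := dist_triangle I (prefixProd ω j • I) (polar t (φ (f m)))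
      rw [dist_I_polar, abs_of_nonneg ht, dist_comm (prefixProd ω j • I)] at h3
      change t ≤ _
      linarith
    obtain ⟨⟨t, ψ'⟩, ⟨⟨ht, -⟩, h3, h4⟩, rfl⟩ :=
      (hA.image continuous_snd).isClosed.mem_of_tendsto hlim hmem
    exact ⟨t, ht.1, h3, h4⟩
  obtain ⟨x, hx⟩ := exists_isRayTo_polar ψ
  refine ⟨x, ⟨_, hx, R, fun T => ?_⟩, _, hx, fun n => ⟨hω.mem n, ?_⟩⟩
  · obtain ⟨n, hn⟩ := ((hG.tendsto_dist_prefixProd hω).eventually_ge_atTop (T + R)).exists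
    obtain ⟨j, hjn, h0, h1, h2⟩ := hrun n
    obtain ⟨t, ht, -, htR⟩ := key j h0 h1 h2
    refine ⟨⟨t, ht⟩, ?_, prefixProd ω j, prefixProd_mem hω.mem j, htR⟩
    have h3 := dist_triangle I (polar t ψ) (prefixProd ω j • I)
    rw [dist_I_polar, abs_of_nonneg ht] at h3
    have h4 := (hG.strictMono_dist_prefixProd hω).monotone hjn
    change (T : ℝ) ≤ t
    linarith
  · obtain ⟨j, hjn, h0, h1, h2⟩ := hrun n
    obtain ⟨t, ht, htj, -⟩ := key j h0 h1 h2
    obtain ⟨τ, hτ, hτ0⟩ := hG.exists_crossing hω ht (hG.wordGap_nonpos_of_le hω hjn htj)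
    obtain ⟨m1, m2⟩ := hG.mem_smul_dirichlet_of_wordGap_eq_zero hω.mem hτ0
    refine ⟨⟨τ, hτ.1⟩, ⟨m1, fun s hs => ?_⟩, m2⟩
    by_contra hlt
    have hlt' : τ < s := not_le.1 hlt
    have hneg := (hypLinear_wordGap_polar ω n ψ).neg_of_pos_of_nonpos (t₀ := 0)
      (by rw [polar_zero]; exact hG.wordGap_I_pos hω n) hτ.1 hτ0.le hlt'
    have hle := (mem_smul_dirichlet (prefixProd_mem hω.mem n)).1 hs (prefixProd ω (n + 1))
      (prefixProd_mem hω.mem _)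
    exact absurd hle (not_le.2 (gap_neg_iff.1 hneg))

end CuspWinding

namespace CuspWinding

/-! ### Words of the form `γ ^ n₀ δ γ ^ n₁ δ ⋯` -/

variable {G : Subgroup SL(2, ℝ)} {γ δ : SL(2, ℝ)}

/-- The product `γ ^ n₀ δ ⋯ γ ^ nₖ₋₁ δ`. -/
def blockProd (γ δ : SL(2, ℝ)) (n : ℕ → ℕ) : ℕ → SL(2, ℝ)
  | 0 => 1
  | k + 1 => blockProd γ δ n k * γ ^ n k * δ

/-- The number of letters of `γ ^ n₀ δ ⋯ γ ^ nₖ₋₁ δ`. -/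
def pairStart (n : ℕ → ℕ) (k : ℕ) : ℕ := ∑ j ∈ Finset.range k, (n j + 1)

lemma pairStart_zero (n : ℕ → ℕ) : pairStart n 0 = 0 := rfl

lemma pairStart_succ (n : ℕ → ℕ) (k : ℕ) : pairStart n (k + 1) = pairStart n k + n k + 1 := by
  rw [pairStart, Finset.sum_range_succ, pairStart, add_assoc]

lemma strictMono_pairStart (n : ℕ → ℕ) : StrictMono (pairStart n) :=
  strictMono_nat_of_lt_succ fun k => by rw [pairStart_succ]; omega

/-- The starting points of the blocks of `γ ^ n₀ δ γ ^ n₁ δ ⋯`. -/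
def blockStart (n : ℕ → ℕ) (i : ℕ) : ℕ := pairStart n (i / 2) + if i % 2 = 0 then 0 else n (i / 2)

lemma blockStart_even (n : ℕ → ℕ) (k : ℕ) : blockStart n (2 * k) = pairStart n k := by
  rw [blockStart, if_pos (by omega), show 2 * k / 2 = k by omega, add_zero]

lemma blockStart_odd (n : ℕ → ℕ) (k : ℕ) : blockStart n (2 * k + 1) = pairStart n k + n k := by
  rw [blockStart, if_neg (by omega), show (2 * k + 1) / 2 = k by omega]

open Classical in
/-- The infinite word `γ ^ n₀ δ γ ^ n₁ δ ⋯`. -/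
noncomputable def blockWord (γ δ : SL(2, ℝ)) (n : ℕ → ℕ) (m : ℕ) : SL(2, ℝ) :=
  if ∃ k, m + 1 = pairStart n (k + 1) then δ else γ

lemma blockWord_eq_or (γ δ : SL(2, ℝ)) (n : ℕ → ℕ) (m : ℕ) :
    blockWord γ δ n m = γ ∨ blockWord γ δ n m = δ := by
  rw [blockWord]
  split_ifs
  · exact Or.inr rfl
  · exact Or.inl rfl

lemma blockWord_last (γ δ : SL(2, ℝ)) (n : ℕ → ℕ) (k : ℕ) :
    blockWord γ δ n (pairStart n k + n k) = δ :=
  if_pos ⟨k, (pairStart_succ n k).symm⟩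

lemma blockWord_of_lt (γ δ : SL(2, ℝ)) (n : ℕ → ℕ) {k m : ℕ} (h1 : pairStart n k ≤ m)
    (h2 : m < pairStart n k + n k) : blockWord γ δ n m = γ := by
  refine if_neg ?_
  rintro ⟨k', hk'⟩
  rcases le_or_gt (k' + 1) k with h | h
  · have := (strictMono_pairStart n).monotone h
    omega
  · have := (strictMono_pairStart n).monotone h
    rw [Nat.succ_eq_add_one, pairStart_succ] at this
    omega

lemma prefixProd_blockWord_add (γ δ : SL(2, ℝ)) (n : ℕ → ℕ) (k : ℕ) :
    prefixProd (blockWord γ δ n) (pairStart n k + n k) =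
      prefixProd (blockWord γ δ n) (pairStart n k) * γ ^ n k := by
  have (i : ℕ) (hi : i ≤ n k) : prefixProd (blockWord γ δ n) (pairStart n k + i) =
      prefixProd (blockWord γ δ n) (pairStart n k) * γ ^ i := by
    induction i with
    | zero => simp
    | succ i ih =>
      rw [← add_assoc, prefixProd_succ, ih (by omega),
        blockWord_of_lt γ δ n (k := k) (by omega) (by omega), pow_succ, mul_assoc]
  exact this _ le_rfl

lemma prefixProd_blockWord (γ δ : SL(2, ℝ)) (n : ℕ → ℕ) (k : ℕ) :
    prefixProd (blockWord γ δ n) (pairStart n k) = blockProd γ δ n k := by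
  induction k with
  | zero => rw [pairStart_zero, prefixProd_zero, blockProd]
  | succ k ih =>
    rw [pairStart_succ, prefixProd_succ, prefixProd_blockWord_add, blockWord_last, ih, blockProd]

/-- A parabolic side pairing `γ` and a second one `δ`. -/
structure IsLetterPair (G : Subgroup SL(2, ℝ)) (γ δ : SL(2, ℝ)) : Prop where
  left_mem : γ ∈ sidePairings G
  right_mem : δ ∈ sidePairings G
  isParabolic : γ.1.IsParabolic
  isHyperbolic_or : δ.1.IsHyperbolic ∨ δ.1.IsParabolic
  left_ne_inv : γ ≠ γ⁻¹
  right_ne_inv : δ ≠ δ⁻¹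
  ne : δ ≠ γ
  ne_inv : δ ≠ γ⁻¹

namespace IsLetterPair

variable (h : IsLetterPair G γ δ)
include h

lemma isReducedWord (n : ℕ → ℕ) : IsReducedWord G (blockWord γ δ n) where
  mem m := by
    rcases blockWord_eq_or γ δ n m with e | e <;> rw [e]
    · exact h.left_mem
    · exact h.right_mem
  ne_inv m := by
    rcases blockWord_eq_or γ δ n m with e | e <;> rcases blockWord_eq_or γ δ n (m + 1) with e' | e' <;>
      rw [e, e']
    · exact h.left_ne_inv
    · exact h.ne_inv
    · intro e''
      exact h.ne_inv (by rw [e'', inv_inv])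
    · exact h.right_ne_inv

lemma isBlockDecomposition {n : ℕ → ℕ} (hn : ∀ k, 2 ≤ n k) :
    IsBlockDecomposition (blockWord γ δ n) (blockStart n) := by
  refine ⟨rfl, fun i => ?_⟩
  rcases Nat.even_or_odd' i with ⟨k, rfl | rfl⟩
  · right
    have := hn k
    have e : blockWord γ δ n (pairStart n k) = γ :=
      blockWord_of_lt γ δ n le_rfl (by omega)
    rw [blockStart_even, blockStart_odd, e]
    refine ⟨h.isParabolic, by omega, fun m h1 h2 => blockWord_of_lt γ δ n h1 h2, ?_⟩
    rw [blockWord_last]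
    exact h.ne
  · rw [show 2 * k + 1 + 1 = 2 * (k + 1) by ring, blockStart_odd, blockStart_even, blockWord_last,
      pairStart_succ]
    rcases h.isHyperbolic_or with hδ | hδ
    · exact Or.inl ⟨hδ, rfl⟩
    · refine Or.inr ⟨hδ, by omega, fun m h1 h2 => ?_, ?_⟩
      · obtain rfl : m = pairStart n k + n k := by omega
        exact blockWord_last γ δ n k
      · have := hn (k + 1)
        rw [← pairStart_succ, blockWord_of_lt γ δ n (k := k + 1) le_rfl (by omega)]
        exact h.ne.symm

lemma exists_isExpansion (hG : IsTreeLike G) {n : ℕ → ℕ} (hn : ∀ k, 2 ≤ n k) :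
    ∃ x ∈ radialLimitSet G, IsExpansion G x (blockWord γ δ n) := by
  refine hG.exists_isExpansion (h.isReducedWord n) h.left_mem h.isParabolic fun m => ?_
  have h1 := hn m
  have h2 : m ≤ pairStart n m := (strictMono_pairStart n).le_apply
  -- The last two letters of run number `m`, which `δ` follows.
  refine ⟨pairStart n m + (n m - 2), by omega, blockWord_of_lt γ δ n (k := m) (by omega) (by omega),
    blockWord_of_lt γ δ n (k := m) (by omega) (by omega), ?_⟩
  rw [show pairStart n m + (n m - 2) + 2 = pairStart n m + n m by omega, blockWord_last]
  exact h.ne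

lemma monotone_dist (hG : IsTreeLike G) (n : ℕ → ℕ) :
    Monotone fun k => dist I (blockProd γ δ n k • I) := by
  simp_rw [← prefixProd_blockWord]
  exact (hG.strictMono_dist_prefixProd (h.isReducedWord n)).monotone.comp
    (strictMono_pairStart n).monotone

lemma tendsto_dist (hG : IsTreeLike G) (n : ℕ → ℕ) :
    Tendsto (fun k => dist I (blockProd γ δ n k • I)) atTop atTop := by
  simp_rw [← prefixProd_blockWord]
  exact (hG.tendsto_dist_prefixProd (h.isReducedWord n)).comp
    (strictMono_pairStart n).tendsto_atTop

end IsLetterPair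

lemma cuspWinding_even (n : ℕ → ℕ) (k : ℕ) : cuspWinding (blockStart n) (2 * k) = n k - 1 := by
  rw [cuspWinding, blockStart_odd, blockStart_even]; omega

lemma cuspWinding_odd (n : ℕ → ℕ) (k : ℕ) : cuspWinding (blockStart n) (2 * k + 1) = 0 := by
  rw [cuspWinding, show 2 * k + 1 + 1 = 2 * (k + 1) by ring, blockStart_odd, blockStart_even,
    pairStart_succ]
  omega

/-- Blocks `δ` contribute nothing, and after an odd number of blocks the latest run of `γ` already
counts; hence the rounding up. -/
lemma sum_posLog_cuspWinding (n : ℕ → ℕ) (i : ℕ) :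
    ∑ k ∈ Finset.range i, Real.posLog (cuspWinding (blockStart n) k : ℝ) =
      ∑ k ∈ Finset.range ((i + 1) / 2), Real.posLog ((n k - 1 : ℕ) : ℝ) := by
  induction i with
  | zero => simp
  | succ i ih =>
    rw [Finset.sum_range_succ, ih]
    rcases Nat.even_or_odd' i with ⟨k, rfl | rfl⟩
    · rw [cuspWinding_even, show (2 * k + 1) / 2 = k by omega,
        show (2 * k + 1 + 1) / 2 = k + 1 by omega, Finset.sum_range_succ]
    · rw [cuspWinding_odd, show (2 * k + 1 + 1 + 1) / 2 = k + 1 by omega,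
        show (2 * k + 1 + 1) / 2 = k + 1 by omega, Nat.cast_zero, Real.posLog_zero, add_zero]

lemma dist_mul_smul_I_le (g k : SL(2, ℝ)) :
    dist I ((g * k) • I) ≤ dist I (g • I) + dist I (k • I) := by
  refine (dist_triangle _ (g • I) _).trans (le_of_eq ?_)
  rw [mul_smul, dist_smul]

/-! ### Realising each mean in the unit interval -/

namespace IsLetterPair

variable (h : IsLetterPair G γ δ)
include h

/-- It suffices to control the means at the ends of the pairs of blocks. -/
theorem levelSet_nonempty_of_tendsto (hG : IsTreeLike G) {n : ℕ → ℕ} (hn : ∀ k, 2 ≤ n k) {α : ℝ}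
    (hα : Tendsto (fun k => 2 * (∑ j ∈ Finset.range k, Real.posLog ((n j - 1 : ℕ) : ℝ)) /
      dist I (blockProd γ δ n k • I)) atTop (𝓝 α)) : (levelSet G α).Nonempty := by
  obtain ⟨x, hx, hxω⟩ := h.exists_isExpansion hG hn
  refine ⟨x, hx, _, _, hxω, h.isBlockDecomposition hn, ?_⟩
  set D : ℕ → ℝ := fun i => dist (prefixProd (blockWord γ δ n) (blockStart n i) • I) I
  have hD : Tendsto D atTop atTop := by
    simp only [D, dist_comm _ I]
    exact (hG.tendsto_dist_prefixProd (h.isReducedWord n)).comp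
      (h.isBlockDecomposition hn).strictMono.tendsto_atTop
  set d : ℕ → ℝ := fun k => dist I (blockProd γ δ n k • I)
  -- Replacing an odd block end by the end of its pair leaves the numerator unchanged and alters the
  -- displacement by at most one letter `δ`.
  have hclose (i : ℕ) : |d ((i + 1) / 2) - D i| ≤ dist I (δ • I) := by
    rcases Nat.even_or_odd' i with ⟨k, rfl | rfl⟩
    · simp only [d, D]
      rw [show (2 * k + 1) / 2 = k by omega, blockStart_even, prefixProd_blockWord, dist_comm,
        sub_self, abs_zero]
      exact dist_nonneg
    · simp only [d, D]
      rw [show (2 * k + 1 + 1) / 2 = k + 1 by omega, blockStart_odd, prefixProd_blockWord_add,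
        prefixProd_blockWord, blockProd]
      set g := blockProd γ δ n k * γ ^ n k
      have h1 := dist_triangle I (g • I) (g • δ • I)
      have h2 := dist_triangle I (g • δ • I) (g • I)
      rw [dist_comm (g • δ • I)] at h2
      rw [dist_smul] at h1 h2
      rw [dist_comm (g • I) I, mul_smul g δ, abs_le]
      constructor <;> linarith
  have hκ : Tendsto (fun i => (i + 1) / 2) atTop atTop :=
    tendsto_atTop_atTop.2 fun b => ⟨2 * b, fun i hi => by omega⟩
  have hquot : Tendsto (fun i => 1 + (d ((i + 1) / 2) - D i) / D i) atTop (𝓝 (1 + 0)) := by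
    refine tendsto_const_nhds.add (squeeze_zero_norm' ?_
      ((tendsto_const_nhds (x := dist I (δ • I))).div_atTop hD))
    filter_upwards [hD.eventually_gt_atTop 0] with i hi
    rw [norm_div, Real.norm_eq_abs, Real.norm_eq_abs, abs_of_pos hi]
    gcongr
    exact hclose i
  have hlim := (hα.comp hκ).mul hquot
  rw [add_zero, mul_one] at hlim
  refine hlim.congr' ?_
  have hd : Tendsto (fun i => d ((i + 1) / 2)) atTop atTop := (h.tendsto_dist hG n).comp hκ
  filter_upwards [hD.eventually_gt_atTop 0, hd.eventually_gt_atTop 0] with i hi hi'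
  rw [sum_posLog_cuspWinding]
  simp only [Function.comp_apply]
  change 2 * _ / d ((i + 1) / 2) * _ = 2 * _ / D i
  field_simp
  ring

/-- The displacement grows at most as fast as the winding numbers allow. -/
lemma exists_dist_succ_le : ∃ C : ℝ, 0 ≤ C ∧ ∀ n : ℕ → ℕ, (∀ k, 2 ≤ n k) → ∀ k,
    dist I (blockProd γ δ n (k + 1) • I) ≤
      dist I (blockProd γ δ n k • I) + 2 * Real.posLog ((n k - 1 : ℕ) : ℝ) + C := by
  obtain ⟨Ψ, hΨ⟩ := exists_isCuspChart h.isParabolic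
  set b := (Ψ I).im
  have hb : 0 < b := (Ψ I).im_pos
  have hlog : 0 ≤ Real.log (2 + 1 / b ^ 2) := Real.log_nonneg (by
    have : 0 < 1 / b ^ 2 := by positivity
    linarith)
  have hlog2 : 0 ≤ Real.log 2 := Real.log_nonneg one_le_two
  -- The first term comes from `γ ^ n k` in the chart, `2 log 2` from replacing `n k` by `n k - 1`,
  -- and the last from `δ`.
  refine ⟨Real.log (2 + 1 / b ^ 2) + 2 * Real.log 2 + dist I (δ • I), by positivity,
    fun n hn k => ?_⟩
  have hpow : dist I (γ ^ n k • I) ≤ 2 * Real.log (n k) + Real.log (2 + 1 / b ^ 2) := by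
    have hnk : (1 : ℝ) ≤ n k := by exact_mod_cast one_le_two.trans (hn k)
    have hc : Real.cosh (dist I (γ ^ n k • I)) = 1 + (n k : ℝ) ^ 2 / (2 * b * b) := by
      rw [← hΨ.isometry.dist_eq, cosh_dist_eq, hΨ.re_pow_smul, hΨ.im_pow_smul, hΨ.re_I]
      ring
    have he : Real.exp (dist I (γ ^ n k • I)) ≤ (n k : ℝ) ^ 2 * (2 + 1 / b ^ 2) := by
      rw [Real.cosh_eq] at hc
      have h1 := Real.exp_pos (-dist I (γ ^ n k • I))
      have h2 : (n k : ℝ) ^ 2 * (2 + 1 / b ^ 2) =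
          2 * (n k : ℝ) ^ 2 + 2 * ((n k : ℝ) ^ 2 / (2 * b * b)) := by
        field_simp
      rw [h2]
      nlinarith
    have := (Real.le_log_iff_exp_le (by positivity)).2 he
    rwa [Real.log_mul (by positivity) (by positivity), Real.log_pow, Nat.cast_ofNat] at this
  have hn1 : Real.log (n k) ≤ Real.posLog ((n k - 1 : ℕ) : ℝ) + Real.log 2 := by
    have h2 := hn k
    have e : ((n k - 1 : ℕ) : ℝ) = (n k : ℝ) - 1 := by
      rw [Nat.cast_sub (by omega), Nat.cast_one]
    have h2' : (2 : ℝ) ≤ n k := by exact_mod_cast h2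
    rw [Real.log_of_nat_eq_posLog, e, ← Real.log_mul (by linarith) two_ne_zero]
    exact Real.log_le_log (by linarith) (by linarith)
  have h1 := dist_mul_smul_I_le (blockProd γ δ n k * γ ^ n k) δ
  have h2 := dist_mul_smul_I_le (blockProd γ δ n k) (γ ^ n k)
  rw [blockProd]
  linarith

omit h in
/-- Exponents may be chosen depending on the previous ones. -/
lemma exists_exponents (F : SL(2, ℝ) → ℝ → ℕ) : ∃ n : ℕ → ℕ, ∀ k,
    n k = F (blockProd γ δ n k) (∑ j ∈ Finset.range k, Real.posLog ((n j - 1 : ℕ) : ℝ)) := by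
  let P : ℕ → SL(2, ℝ) × ℝ := fun k => Nat.rec (1, 0)
    (fun _ p => (p.1 * γ ^ F p.1 p.2 * δ, p.2 + Real.posLog ((F p.1 p.2 - 1 : ℕ) : ℝ))) k
  refine ⟨fun k => F (P k).1 (P k).2, fun k => ?_⟩
  have (k : ℕ) : blockProd γ δ (fun k => F (P k).1 (P k).2) k = (P k).1 ∧
      ∑ j ∈ Finset.range k, Real.posLog ((F (P j).1 (P j).2 - 1 : ℕ) : ℝ) = (P k).2 := by
    induction k with
    | zero => exact ⟨rfl, rfl⟩
    | succ k ih =>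
      refine ⟨?_, ?_⟩
      · rw [blockProd, ih.1]
      · rw [Finset.sum_range_succ, ih.2]
  rw [(this k).1, (this k).2]

lemma levelSet_nonempty_of_abs_le (hG : IsTreeLike G) {n : ℕ → ℕ} (hn : ∀ k, 2 ≤ n k) {α : ℝ}
    {e : ℕ → ℝ} (he : ∀ k, |2 * (∑ j ∈ Finset.range k, Real.posLog ((n j - 1 : ℕ) : ℝ)) -
      α * dist I (blockProd γ δ n k • I)| ≤ e k)
    (hlim : Tendsto (fun k => e k / dist I (blockProd γ δ n k • I)) atTop (𝓝 0)) :
    (levelSet G α).Nonempty := by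
  refine h.levelSet_nonempty_of_tendsto hG hn ?_
  have hd := h.tendsto_dist hG n
  rw [← tendsto_sub_nhds_zero_iff]
  refine squeeze_zero_norm' ?_ hlim
  filter_upwards [hd.eventually_gt_atTop 0] with k hk
  rw [Real.norm_eq_abs, div_sub' hk.ne', abs_div, abs_of_pos hk]
  gcongr
  rw [mul_comm (dist _ _)]
  exact he k

/-- Greedy choice: while `2 ∑ log⁺ a - α d` is nonpositive take winding number `m`, otherwise take
`1`, whose logarithm is `0`. The first move raises this quantity by at most `2 u` and never lowers
it; the second lowers it by at most `α C` and never raises it. It thus stays bounded while `d` tends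
to infinity. -/
theorem levelSet_nonempty_of_lt_one (hG : IsTreeLike G) {α : ℝ} (h0 : 0 ≤ α) (h1 : α < 1) :
    (levelSet G α).Nonempty := by
  obtain ⟨C, hC, hstep⟩ := h.exists_dist_succ_le
  -- Chosen so that `α (2 u + C) ≤ 2 u` for `u = log m`, which is possible because `α < 1`.
  obtain ⟨m, hm⟩ := exists_nat_ge (Real.exp (α * C / (2 * (1 - α))))
  have hmpos : (0 : ℝ) < m := (Real.exp_pos _).trans_le hm
  have hm1 : 1 ≤ m := by exact_mod_cast hmpos
  set u := Real.posLog (m : ℝ)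
  have hu0 : 0 ≤ u := Real.posLog_nonneg
  have hu : α * (2 * u + C) ≤ 2 * u := by
    have h2 : α * C / (2 * (1 - α)) ≤ u := by
      simp only [u]
      rw [Real.log_of_nat_eq_posLog]
      exact (Real.le_log_iff_exp_le hmpos).2 hm
    rw [div_le_iff₀ (by linarith)] at h2
    linarith
  classical
  obtain ⟨n, hn⟩ := exists_exponents (γ := γ) (δ := δ)
    fun g s => if 2 * s ≤ α * dist I (g • I) then m + 1 else 2
  have hn2 (k : ℕ) : 2 ≤ n k := by
    rw [hn]; split_ifs <;> omega
  have hE (k : ℕ) : -(α * C) ≤ 2 * (∑ j ∈ Finset.range k, Real.posLog ((n j - 1 : ℕ) : ℝ)) -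
      α * dist I (blockProd γ δ n k • I) ∧
      2 * (∑ j ∈ Finset.range k, Real.posLog ((n j - 1 : ℕ) : ℝ)) -
      α * dist I (blockProd γ δ n k • I) ≤ 2 * u := by
    induction k with
    | zero =>
      simp only [Finset.range_zero, Finset.sum_empty, mul_zero, blockProd, one_smul, dist_self,
        sub_self]
      exact ⟨neg_nonpos.2 (mul_nonneg h0 hC), by linarith⟩
    | succ k ih =>
      have hs := mul_le_mul_of_nonneg_left (hstep n hn2 k) h0
      have hmono := mul_le_mul_of_nonneg_left (h.monotone_dist hG n (Nat.le_succ k)) h0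
      simp only [Nat.succ_eq_add_one] at hmono
      rw [Finset.sum_range_succ]
      have hnk := hn k
      split_ifs at hnk with hcase
      · rw [hnk, Nat.add_sub_cancel] at hs ⊢
        change _ ≤ α * (_ + 2 * u + C) at hs
        change _ ≤ 2 * (_ + u) - _ ∧ 2 * (_ + u) - _ ≤ _
        constructor <;> linarith [ih.1, ih.2]
      · rw [hnk] at hs ⊢
        have e : Real.posLog ((2 - 1 : ℕ) : ℝ) = 0 := by norm_num
        rw [e] at hs ⊢
        have hcase' := not_le.1 hcase
        constructor <;> linarith [ih.1, ih.2]
  refine h.levelSet_nonempty_of_abs_le hG hn2 (e := fun _ => 2 * u + α * C) (fun k => ?_)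
    (tendsto_const_nhds.div_atTop (h.tendsto_dist hG n))
  have hαC := mul_nonneg h0 hC
  rw [abs_le]
  constructor <;> linarith [(hE k).1, (hE k).2]

/-- After `k` pairs, `d` and `2 ∑ log⁺ a` differ by at most `C k + |C'|`. Winding numbers `2 ^ ((k +
1) ^ 2)` make `d` grow at least quadratically, so the ratio tends to `1`. -/
theorem levelSet_one_nonempty (hG : IsTreeLike G) : (levelSet G 1).Nonempty := by
  obtain ⟨C, hC, hstep⟩ := h.exists_dist_succ_le
  obtain ⟨C', hC'⟩ := hG.exists_sum_posLog_le
  set n : ℕ → ℕ := fun k => 2 ^ ((k + 1) ^ 2) + 1 with hndef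
  have hn (k : ℕ) : 2 ≤ n k := by
    have : 0 < 2 ^ ((k + 1) ^ 2) := by positivity
    simp only [n]
    omega
  set s : ℕ → ℝ := fun k => ∑ j ∈ Finset.range k, Real.posLog ((n j - 1 : ℕ) : ℝ) with hs
  set d : ℕ → ℝ := fun k => dist I (blockProd γ δ n k • I) with hd
  have hupper (k : ℕ) : d k ≤ 2 * s k + C * k := by
    induction k with
    | zero => simp [d, s, blockProd]
    | succ k ih =>
      have h1 := hstep n hn k
      change d (k + 1) ≤ d k + _ + C at h1
      have h2 : s (k + 1) = s k + Real.posLog ((n k - 1 : ℕ) : ℝ) := Finset.sum_range_succ _ _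
      rw [h2]
      push_cast
      linarith
  have hlower (k : ℕ) : 2 * s k ≤ d k + C' := by
    have := hC' _ _ (h.isReducedWord n) (h.isBlockDecomposition hn) (2 * k)
    rwa [sum_posLog_cuspWinding, blockStart_even, prefixProd_blockWord,
      show (2 * k + 1) / 2 = k by omega] at this
  have hsq (k : ℕ) : (k : ℝ) ^ 2 ≤ 2 * s k := by
    cases k with
    | zero => simp [s]
    | succ k =>
      have h1 : Real.posLog ((n k - 1 : ℕ) : ℝ) ≤ s (k + 1) :=
        Finset.single_le_sum (f := fun j => Real.posLog ((n j - 1 : ℕ) : ℝ))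
          (fun j _ => Real.posLog_nonneg) (Finset.self_mem_range_succ k)
      have h2 : Real.posLog ((n k - 1 : ℕ) : ℝ) = ((k : ℝ) + 1) ^ 2 * Real.log 2 := by
        rw [Real.log_of_nat_eq_posLog]
        simp only [n, Nat.add_sub_cancel]
        push_cast
        rw [Real.log_pow]
        push_cast
        ring
      -- Only `1 / 2 ≤ log 2` matters here.
      have h3 := Real.log_two_gt_d9
      push_cast
      nlinarith [sq_nonneg ((k : ℝ) + 1)]
  refine h.levelSet_nonempty_of_abs_le hG hn (e := fun k => C * k + |C'|) (fun k => ?_) ?_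
  · change |2 * s k - 1 * d k| ≤ _
    have h1 := le_abs_self C'
    have h2 : 0 ≤ C * k := by positivity
    have h3 := abs_nonneg C'
    rw [abs_le]
    constructor <;> linarith [hupper k, hlower k]
  · change Tendsto (fun k : ℕ => (C * k + |C'|) / d k) atTop (𝓝 0)
    have hz : Tendsto (fun k : ℕ => 2 * (C + |C'|) / (k : ℝ)) atTop (𝓝 0) :=
      tendsto_const_nhds.div_atTop tendsto_natCast_atTop_atTop
    refine squeeze_zero' (Eventually.of_forall fun k => by positivity) ?_ hz
    filter_upwards [tendsto_natCast_atTop_atTop.eventually_ge_atTop (2 * |C'| + 1)] with k hk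
    have h1 := le_abs_self C'
    have h3 := abs_nonneg C'
    have hk1 : (1 : ℝ) ≤ k := by linarith
    have hdk : (k : ℝ) ^ 2 / 2 ≤ d k := by
      have := hlower k
      have := hsq k
      nlinarith
    rw [div_le_div_iff₀ (by nlinarith) (by linarith)]
    have h4 : (C * k + |C'|) * k ≤ (C + |C'|) * (k : ℝ) ^ 2 := by
      nlinarith [mul_nonneg h3 (mul_nonneg (by linarith : (0 : ℝ) ≤ k)
        (by linarith : (0 : ℝ) ≤ (k : ℝ) - 1))]
    have h5 : (C + |C'|) * (k : ℝ) ^ 2 ≤ (C + |C'|) * (2 * d k) :=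
      mul_le_mul_of_nonneg_left (by linarith) (by positivity)
    linarith

end IsLetterPair

/-- A parabolic generator exists since `v ≥ 1`, a second generator since `u + v > 1`; distinct
letters of a free basis and their inverses have distinct images. -/
lemma exists_isLetterPair {u v : ℕ} (hv : 1 ≤ v) (huv : 1 < u + v) {h : Fin u → SL(2, ℝ)}
    {γ : Fin v → SL(2, ℝ)} (hhyp : ∀ i, (h i).1.IsHyperbolic) (hpar : ∀ j, (γ j).1.IsParabolic)
    (hfree : Function.Injective (FreeGroup.lift (Sum.elim h γ)))
    (hside : sidePairings G = symmGenerators h γ) : ∃ g k, IsLetterPair G g k := by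
  have key (a b : Fin u ⊕ Fin v) (hab : a ≠ b) (ha : (Sum.elim h γ a).1.IsParabolic)
      (hb : (Sum.elim h γ b).1.IsHyperbolic ∨ (Sum.elim h γ b).1.IsParabolic) :
      IsLetterPair G (Sum.elim h γ a) (Sum.elim h γ b) := by
    set f := FreeGroup.lift (Sum.elim h γ)
    have e (c : Fin u ⊕ Fin v) : Sum.elim h γ c = f (FreeGroup.mk [(c, true)]) := by simp [f]
    have e' (c : Fin u ⊕ Fin v) : (Sum.elim h γ c)⁻¹ = f (FreeGroup.mk [(c, false)]) := by simp [f]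
    have hmem (c : Fin u ⊕ Fin v) : Sum.elim h γ c ∈ sidePairings G := by
      rw [hside, mem_symmGenerators_iff]
      exact ⟨_, e c⟩
    have hne {x y : (Fin u ⊕ Fin v) × Bool} (hxy : x ≠ y) :
        f (FreeGroup.mk [x]) ≠ f (FreeGroup.mk [y]) := by
      intro he
      apply hxy
      simpa using congrArg FreeGroup.toWord (hfree he)
    refine ⟨hmem a, hmem b, ha, hb, ?_, ?_, ?_, ?_⟩
    · rw [e', e]; exact hne (by simp)
    · rw [e', e]; exact hne (by simp)
    · rw [e, e]; exact hne (by simp [hab.symm])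
    · rw [e', e]; exact hne (by simp)
  rcases Nat.eq_zero_or_pos u with hu | hu
  · exact ⟨_, _, key (Sum.inr ⟨0, hv⟩) (Sum.inr ⟨1, by omega⟩) (by simp) (hpar _)
      (Or.inr (hpar _))⟩
  · exact ⟨_, _, key (Sum.inr ⟨0, hv⟩) (Sum.inl ⟨0, hu⟩) (by simp) (hpar _) (Or.inl (hhyp _))⟩

end CuspWinding

/-- Let `G` be a Fuchsian group, freely generated by the hyperbolic elements `h₁, …, h_u` and the
parabolic elements `γ₁, …, γ_v`, where `v ≥ 1` and `u + v > 1`, such that these generators and their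
inverses are the side-pairing elements of the Dirichlet domain centred at `i`. Then the level set
of the mean cusp-winding number is nonempty if and only if `α ∈ [0, 1]`.
(`G` is given inside `SL(2, ℝ)`; a free subgroup of `PSL(2, ℝ)` always lifts there.) -/
theorem fact4 (G : Subgroup SL(2, ℝ)) (hdisc : DiscreteTopology G)
    (u v : ℕ) (hv : 1 ≤ v) (huv : 1 < u + v)
    (h : Fin u → SL(2, ℝ)) (γ : Fin v → SL(2, ℝ))
    (hhyp : ∀ i, (h i).1.IsHyperbolic) (hpar : ∀ j, (γ j).1.IsParabolic)
    (hfree : Function.Injective (FreeGroup.lift (Sum.elim h γ)))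
    (hgen : (FreeGroup.lift (Sum.elim h γ)).range = G)
    (hside : CuspWinding.sidePairings G = CuspWinding.symmGenerators h γ)
    (α : ℝ) :
    (CuspWinding.levelSet G α).Nonempty ↔ α ∈ Set.Icc (0 : ℝ) 1 := by
  have hG := CuspWinding.isTreeLike_of_free hdisc hfree hgen hside
  refine ⟨hG.mem_Icc_of_levelSet_nonempty, fun hα => ?_⟩
  obtain ⟨g, k, hgk⟩ := CuspWinding.exists_isLetterPair hv huv hhyp hpar hfree hside
  rcases hα.2.eq_or_lt with rfl | hlt
  · exact hgk.levelSet_one_nonempty hG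
  · exact hgk.levelSet_nonempty_of_lt_one hG hα.1 hlt
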